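/- Let $r\in\{2,3\}$ and let $C=\{x\in\mathbb R^r : x\cdot v_i\ge 0,\ i=1,\dots,N\}$ be an $r$-dimensional cone (i.e. with non-empty interior) that contains no line, presented by its minimal set of primitive normals $v_i\in\mathbb Z^r$. Assume that $C$ is *good*: for $0<k<r$, at each face of codimension $k$ exactly $k$ of the normals meet, and $\mathrm{Span}_{\mathbb R}\langle v_{i_1},\dots,v_{i_k}\rangle\cap\mathbb Z^r=\mathrm{Span}_{\mathbb Z}\langle v_{i_1},\dots,v_{i_k}\rangle$ for these normals. If $r=3$, assume moreover that $C$ is *1-Gorenstein*: there is a primitive $\xi\in\mathbb Z^3$ with $\xi\cdot v_i=1$ for all $i$. Let $C^*=\{y\in\mathbb R^r : y\cdot u\ge 0\ \forall u\in C\}$ be the dual cone, and let $\underline\omega\in\mathbb C^r$ be such that $\mathrm{Re}(a\,\underline\omega)\in (C^*)^\circ$ for some $a\in\mathbb C^*$; we may take $a=e^{-i\theta}$ with $\theta\in\mathbb R$, and call such a $\theta$ *admissible* for $\underline\omega$. For admissible $\theta$ define all powers $x^{-s}=e^{-s\log x}$ by the branch of the logarithm with imaginary part in $(\theta-\pi,\theta+\pi]$.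 For $A=C$ or $A=C^\circ$ let $$\zeta_r^{A}(s,z|\underline\omega)=\sum_{n\in A\cap\mathbb Z^r}\frac1{(z+n\cdot\underline\omega)^s}\qquad(\mathrm{Re}\,s>r),$$ continued analytically in $s$ to $\mathbb C\setminus\{1,\dots,r\}$, let $$\Gamma_r^{A}(z|\underline\omega)=\exp\Big(\tfrac{\partial}{\partial s}\zeta_r^{A}(s,z|\underline\omega)\big|_{s=0}\Big)$$ if $z+n\cdot\underline\omega\ne0$ for all $n\in A\cap\mathbb Z^r$ (the remaining $z$ are the poles of $\Gamma_r^A$, where $1/\Gamma_r^A$ is $0$), and let $$S_r^C(z|\underline\omega)=\Gamma_r^C(z|\underline\omega)^{-1}\,\Gamma_r^{C^\circ}(-z|\underline\omega)^{(-1)^r}.$$ At a pole of $\Gamma_r^{A}$ the value of $\Gamma_r^{A}$ itself is taken to be $0$ by convention. Then, whenever $z+n\cdot\underline\omega\neq 0$ for all $n\in C\cap\mathbb Z^r$ (respectively $-z+n\cdot\underline\omega\neq0$ for all $n\in C^\circ\cap\mathbb Z^r$), the series $\zeta_r^{C}(s,z|\underline\omega)$ (respectively $\zeta_r^{C^\circ}(s,-z|\underline\omega)$)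 converges absolutely for $\mathrm{Re}\,s>r$ and has the stated continuation, and $$S_r^C(cz\,|\,c\,\underline\omega)=S_r^C(z\,|\,\underline\omega)\qquad\text{for all } c\in\mathbb C^*,\ z\in\mathbb C,$$ whichever admissible $\theta$ for $\underline\omega$ and $\theta'$ for $c\,\underline\omega$ are used on the right and on the left. -/

import Mathlib

open scoped Matrix

noncomputable section

namespace GenSine

/-- The real vector underlying an integer vector. -/
def toReal {r : ℕ} (n : Fin r → ℤ) : Fin r → ℝ := fun j => (n j : ℝ)

/-- An integer vector is primitive when its entries have no common divisor except units
(in particular it is nonzero). -/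
def IsPrimitive {r : ℕ} (v : Fin r → ℤ) : Prop :=
  ∀ d : ℤ, (∀ j, d ∣ v j) → IsUnit d

/-- The polyhedral cone with inward pointing normals `V`. -/
def polyCone {r : ℕ} (V : Set (Fin r → ℤ)) : Set (Fin r → ℝ) :=
  {x | ∀ v ∈ V, 0 ≤ x ⬝ᵥ toReal v}

/-- The dual of a subset of `ℝ^r`. -/
def dualCone {r : ℕ} (S : Set (Fin r → ℝ)) : Set (Fin r → ℝ) :=
  {y | ∀ u ∈ S, 0 ≤ y ⬝ᵥ u}

/-- An `r`-dimensional strictly convex rational polyhedral cone in `ℝ^r`, presented by its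
minimal set of primitive inward pointing normals. -/
structure RatCone (r : ℕ) where
  normals : Finset (Fin r → ℤ)
  primitive : ∀ v ∈ normals, IsPrimitive v
  minimal : ∀ v ∈ normals, polyCone ((normals : Set (Fin r → ℤ)) \ {v}) ≠ polyCone normals
  strictlyConvex : ∀ x, x ∈ polyCone (normals : Set (Fin r → ℤ)) →
    -x ∈ polyCone (normals : Set (Fin r → ℤ)) → x = 0
  fullDimensional : (interior (polyCone (normals : Set (Fin r → ℤ)))).Nonempty

namespace RatCone

variable {r : ℕ}

/-- The cone as a subset of `ℝ^r`. -/
def carrier (C : RatCone r) : Set (Fin r → ℝ) := polyCone (C.normals : Set (Fin r → ℤ))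

/-- The face of `C` cut out by a set `I` of normals. -/
def face (C : RatCone r) (I : Set (Fin r → ℤ)) : Set (Fin r → ℝ) :=
  {x | x ∈ C.carrier ∧ ∀ v ∈ I, x ⬝ᵥ toReal v = 0}

/-- The normals of `C` that vanish on a subset `F` of `ℝ^r`. -/
def normalsAt (C : RatCone r) (F : Set (Fin r → ℝ)) : Set (Fin r → ℤ) :=
  {v | v ∈ C.normals ∧ ∀ x ∈ F, x ⬝ᵥ toReal v = 0}

/-- Goodness: at every face of codimension `k`, other than the apex (`k = r`) and the
cone itself (`k = 0`), exactly `k` normals meet, and their real span contains no more lattice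
points than their integral span. -/
def IsGood (C : RatCone r) : Prop :=
  ∀ I : Set (Fin r → ℤ), I ⊆ C.normals → ∀ k : ℕ, 0 < k → k < r →
    Module.finrank ℝ (Submodule.span ℝ (C.face I)) + k = r →
      (C.normalsAt (C.face I)).ncard = k ∧
      ∀ m : Fin r → ℤ,
        toReal m ∈ Submodule.span ℝ (toReal '' C.normalsAt (C.face I)) ↔
          m ∈ Submodule.span ℤ (C.normalsAt (C.face I))

/-- The 1-Gorenstein condition. -/
def IsOneGorenstein (C : RatCone r) : Prop :=
  ∃ ξ : Fin r → ℤ, IsPrimitive ξ ∧ ∀ v ∈ C.normals, ξ ⬝ᵥ v = 1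

end RatCone

/-- The branch of the logarithm on `ℂ \ {0}` with imaginary part in `(θ - π, θ + π]`. -/
def branchLog (θ : ℝ) (x : ℂ) : ℂ :=
  Complex.log (Complex.exp (-(θ * Complex.I)) * x) + θ * Complex.I

/-- `θ` is an admissible direction for `ω`: with `a = exp (-iθ)`, the real part of `a ω` lies
in the interior of the dual cone. Thus all `n · ω` with `n ≠ 0` in the cone lie in the open
half plane centred on the ray of argument `θ`, opposite to the cut of `branchLog θ`. -/
def RatCone.Admissible {r : ℕ} (C : RatCone r) (ω : Fin r → ℂ) (θ : ℝ) : Prop :=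
  (fun j => (Complex.exp (-(θ * Complex.I)) * ω j).re) ∈ interior (dualCone C.carrier)

/-- The number `z + n · ω`. -/
def shifted {r : ℕ} (ω : Fin r → ℂ) (z : ℂ) (n : Fin r → ℤ) : ℂ :=
  z + ∑ j, (n j : ℂ) * ω j

/-- The lattice points of a subset of `ℝ^r`. -/
def latticePoints {r : ℕ} (S : Set (Fin r → ℝ)) : Set (Fin r → ℤ) :=
  {n | toReal n ∈ S}

/-- No term of the zeta series over `S` at `z` is a power of zero. -/
def Regular {r : ℕ} (S : Set (Fin r → ℝ)) (ω : Fin r → ℂ) (z : ℂ) : Prop :=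
  ∀ n ∈ latticePoints S, shifted ω z n ≠ 0

/-- `Z` is the analytic continuation to `ℂ \ {1, …, r}` of the generalized multiple zeta
function `s ↦ ∑ (z + n · ω)^(-s)`, the sum over the lattice points `n` of `S`, which converges
absolutely for `Re s > r`; powers are taken with `branchLog θ`. -/
def IsZeta {r : ℕ} (S : Set (Fin r → ℝ)) (θ : ℝ) (ω : Fin r → ℂ) (z : ℂ) (Z : ℂ → ℂ) : Prop :=
  DifferentiableOn ℂ Z {s | ∀ k ∈ Finset.Icc 1 r, s ≠ (k : ℂ)} ∧
  ∀ s : ℂ, (r : ℝ) < s.re →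
    HasSum (fun n : latticePoints S => Complex.exp (-s * branchLog θ (shifted ω z n))) (Z s)

open Classical in
/-- The generalized multiple zeta function, continued in `s` (its values off `{1, …, r}` are
determined by `IsZeta`). -/
def coneZeta {r : ℕ} (S : Set (Fin r → ℝ)) (θ : ℝ) (ω : Fin r → ℂ) (z : ℂ) : ℂ → ℂ :=
  if h : ∃ Z : ℂ → ℂ, IsZeta S θ ω z Z then h.choose else 0

open Classical in
/-- The generalized multiple gamma function; at its poles, the points `z = - n · ω` with `n` a
lattice point of `S`, it has the value `0` (so that its reciprocal has its zeros there). -/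
def coneGamma {r : ℕ} (S : Set (Fin r → ℝ)) (θ : ℝ) (ω : Fin r → ℂ) (z : ℂ) : ℂ :=
  if Regular S ω z then Complex.exp (deriv (coneZeta S θ ω z) 0) else 0

/-- The generalized multiple sine function `S_r^C (z | ω)`, computed with `branchLog θ`. -/
def coneSine {r : ℕ} (C : RatCone r) (θ : ℝ) (ω : Fin r → ℂ) (z : ℂ) : ℂ :=
  (coneGamma C.carrier θ ω z)⁻¹ *
    (coneGamma (interior C.carrier) θ ω (-z)) ^ ((-1 : ℤ) ^ r)

end GenSine

end

/-! Put `F t = ∑ exp (-t n·ω)`, summed over the lattice points `n` of `C`, with `ω` rotated so that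
its real part is interior to the dual cone, and let `G` be the same sum over the interior of `C`.
Both continue meromorphically near `0` with a pole of order at most `r`. A Mellin transform divided
by the Gamma function turns `exp (-z t) F t` into the zeta function (up to an entire factor from the
rotation). Its value at `s = 0` is the constant Laurent coefficient at `t = 0`
(`exists_mellin_continuation`).

The core is the reciprocity `G t = (-1)^r F (-t)`, encoded in `Reciprocal`. It gives `ζ^{C°}(0, -z)
= (-1)^r ζ^C(0, z)` (`exists_isZeta_of_reciprocal`). For a half-open simplicial cone it comes from
the reflection `c ↦ 1 - c` of the fundamental parallelepiped (`simplicialSum_compl`). A plane cone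
is simplicial (`RatCone.reciprocal_two`). For `r = 3` the vector `ξ` pairs to `1` with all normals.
The cone is cut into the simplicial cones spanned by a facet and `ξ`, and averaging two opposite
half-open versions of each counts every lattice point correctly (`sum_prism_eq`).

Multiplying `z` and `ω` by `c` adds a constant `L`, a logarithm of `c`, to the logarithm of all but
finitely many terms. The exceptions differ by multiples of `2πi`, which the final exponential
forgets. Hence `Γ` is multiplied by `exp (-L ζ(0))` (`coneGamma_const_mul`), and by the relation
between the two zeta values these factors cancel in the sine. -/

noncomputable section

/-! ### Mellin continuation of a function with an asymptotic expansion at `0` -/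

namespace GenSine

open Filter Topology MeasureTheory Set Asymptotics

/-- `f t` has the asymptotic expansion `∑ a_j t^(j - r)` as `t → 0+`. -/
def HasExpansion (r : ℕ) (f : ℝ → ℂ) (a : ℕ → ℂ) : Prop :=
  ∀ N : ℕ, (fun t : ℝ => f t - ∑ j ∈ Finset.range N, a j * (t : ℂ) ^ ((j : ℂ) - r))
    =O[𝓝[>] 0] fun t : ℝ => t ^ ((N : ℝ) - r)

/-- `f` minus the first `N` terms of its expansion on `(0, 1]`. -/
def truncated (r : ℕ) (f : ℝ → ℂ) (a : ℕ → ℂ) (N : ℕ) (t : ℝ) : ℂ :=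
  f t - ∑ j ∈ Finset.range N,
    a j • (Ioc (0 : ℝ) 1).indicator (fun t : ℝ => (t : ℂ) ^ ((j : ℂ) - r)) t

/-- The quotient of `1 / (s + j - r)` by the Gamma function. -/
def invGammaPart (r j : ℕ) (s : ℂ) : ℂ :=
  if j < r then (Complex.Gamma s)⁻¹ / (s + ((j : ℂ) - r))
  else (∏ i ∈ Finset.range (j - r), (s + i)) * (Complex.Gamma (s + (j - r : ℕ) + 1))⁻¹

theorem inv_Gamma_eq_prod (n : ℕ) (s : ℂ) :
    (Complex.Gamma s)⁻¹ = (∏ i ∈ Finset.range n, (s + i)) * (Complex.Gamma (s + n))⁻¹ := by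
  induction n with
  | zero => simp
  | succ n ih =>
    rw [ih, Finset.prod_range_succ,
      Complex.one_div_Gamma_eq_self_mul_one_div_Gamma_add_one (s + n)]
    push_cast
    ring_nf

/-- For `j ≥ r` the pole of `1 / (s + j - r)` is at a zero of `1 / Γ`. Dropping that factor from the
product formula for `1 / Γ` leaves an entire function, so only the poles `1, …, r` remain. -/
theorem invGammaPart_mul {r j : ℕ} {s : ℂ} (hs : j < r → s + ((j : ℂ) - r) ≠ 0) :
    invGammaPart r j s * (s + ((j : ℂ) - r)) = (Complex.Gamma s)⁻¹ := by
  unfold invGammaPart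
  split_ifs with h
  · exact div_mul_cancel₀ _ (hs h)
  · obtain ⟨n, rfl⟩ := Nat.exists_eq_add_of_le (not_lt.mp h)
    rw [inv_Gamma_eq_prod (n + 1) s, Finset.prod_range_succ]
    simp only [add_tsub_cancel_left]
    push_cast
    ring_nf

/-- This singles out the constant coefficient: `1 / Γ` vanishes at `0` when `j < r`, and the product
contains the factor `s` when `j > r`. -/
theorem invGammaPart_zero (r j : ℕ) : invGammaPart r j 0 = if j = r then 1 else 0 := by
  unfold invGammaPart
  split_ifs with h1 h2 h2
  · omega
  · simp
  · subst h2; simp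
  · obtain ⟨n, rfl⟩ := Nat.exists_eq_add_of_lt (lt_of_le_of_ne (not_lt.mp h1) (Ne.symm h2))
    have : r + n + 1 - r = n + 1 := by omega
    rw [this, Finset.prod_range_succ']
    simp

theorem differentiableAt_invGammaPart {r j : ℕ} {s : ℂ}
    (hs : j < r → s + ((j : ℂ) - r) ≠ 0) : DifferentiableAt ℂ (invGammaPart r j) s := by
  have hG := Complex.differentiable_one_div_Gamma
  unfold invGammaPart
  split_ifs with h
  · exact (hG s).div (by fun_prop) (hs h)
  · refine DifferentiableAt.mul (by fun_prop) ?_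
    exact DifferentiableAt.comp s (g := fun s => (Complex.Gamma s)⁻¹) (hG _) (by fun_prop)

/-- The points off the set `{1, …, r}` of possible poles. -/
abbrev poleFree (r : ℕ) : Set ℂ := {s | ∀ k ∈ Finset.Icc 1 r, s ≠ (k : ℂ)}

theorem zero_mem_poleFree (r : ℕ) : (0 : ℂ) ∈ poleFree r := by
  intro k hk h
  have h1 := (Finset.mem_Icc.mp hk).1
  have h2 : k = 0 := by exact_mod_cast h.symm
  omega

theorem add_sub_ne_zero_of_mem_poleFree {r j : ℕ} {s : ℂ} (hs : s ∈ poleFree r) (hj : j < r) :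
    s + ((j : ℂ) - r) ≠ 0 := by
  intro h
  refine hs (r - j) (Finset.mem_Icc.mpr ⟨by omega, by omega⟩) ?_
  rw [Nat.cast_sub hj.le]
  linear_combination h

theorem locallyIntegrableOn_truncated (r : ℕ) {f : ℝ → ℂ} (a : ℕ → ℂ) (N : ℕ)
    (hf : ContinuousOn f (Ioi 0)) : LocallyIntegrableOn (truncated r f a N) (Ioi 0) := by
  have key : ∀ j : ℕ, LocallyIntegrableOn
      (fun t => a j • (Ioc (0 : ℝ) 1).indicator (fun t : ℝ => (t : ℂ) ^ ((j : ℂ) - r)) t)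
      (Ioi 0) := by
    intro j
    have h1 : ContinuousOn (fun t : ℝ => (t : ℂ) ^ ((j : ℂ) - r)) (Ioi 0) := by
      intro t ht
      refine ContinuousAt.continuousWithinAt ?_
      exact Complex.continuousAt_ofReal_cpow_const _ _ (Or.inr (ne_of_gt ht))
    have h2 := h1.locallyIntegrableOn (μ := volume) measurableSet_Ioi
    intro t ht
    obtain ⟨U, hU, hI⟩ := h2 t ht
    refine ⟨U, hU, ?_⟩
    exact (IntegrableOn.indicator hI measurableSet_Ioc).smul (a j)
  have hsum : ∀ N : ℕ, LocallyIntegrableOn (fun t => ∑ j ∈ Finset.range N,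
      a j • (Ioc (0 : ℝ) 1).indicator (fun t : ℝ => (t : ℂ) ^ ((j : ℂ) - r)) t) (Ioi 0) := by
    intro N
    induction N with
    | zero => simpa using (locallyIntegrable_zero (μ := volume)).locallyIntegrableOn (Ioi (0:ℝ))
    | succ n ih => simp_rw [Finset.sum_range_succ]; exact ih.add (key n)
  exact (hf.locallyIntegrableOn measurableSet_Ioi).sub (hsum N)

theorem truncated_isBigO_atTop (r : ℕ) {f : ℝ → ℂ} (a : ℕ → ℂ) (N : ℕ)
    (hf : f =O[atTop] fun t => Real.exp (-1 * t)) :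
    truncated r f a N =O[atTop] fun t => Real.exp (-1 * t) := by
  refine (EventuallyEq.isBigO ?_).trans hf
  filter_upwards [eventually_gt_atTop 1] with t ht
  simp [truncated, ht]

theorem truncated_isBigO_zero {r : ℕ} {f : ℝ → ℂ} {a : ℕ → ℂ} (N : ℕ)
    (hf : HasExpansion r f a) :
    truncated r f a N =O[𝓝[>] 0] fun t : ℝ => t ^ (-((r : ℝ) - N)) := by
  rw [neg_sub]
  refine (EventuallyEq.isBigO ?_).trans (hf N)
  filter_upwards [Ioc_mem_nhdsGT (zero_lt_one' ℝ)] with t ht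
  simp only [truncated, indicator_of_mem ht, smul_eq_mul]

section

variable {r : ℕ} {f : ℝ → ℂ} {a : ℕ → ℂ}

theorem differentiableAt_mellin_truncated (hc : ContinuousOn f (Ioi 0))
    (hd : f =O[atTop] fun t => Real.exp (-1 * t)) (he : HasExpansion r f a)
    {N : ℕ} {s : ℂ} (hs : (r : ℝ) - N < s.re) :
    DifferentiableAt ℂ (mellin (truncated r f a N)) s :=
  mellin_differentiableAt_of_isBigO_rpow_exp one_pos (locallyIntegrableOn_truncated r a N hc)
    (truncated_isBigO_atTop r a N hd) (truncated_isBigO_zero N he) hs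

theorem mellinConvergent_truncated (hc : ContinuousOn f (Ioi 0))
    (hd : f =O[atTop] fun t => Real.exp (-1 * t)) (he : HasExpansion r f a)
    {N : ℕ} {s : ℂ} (hs : (r : ℝ) - N < s.re) :
    MellinConvergent (truncated r f a N) s :=
  mellinConvergent_of_isBigO_rpow_exp one_pos (locallyIntegrableOn_truncated r a N hc)
    (truncated_isBigO_atTop r a N hd) (truncated_isBigO_zero N he) hs

/-- The term moved out of the truncation is `t^(N - r)` on `(0, 1]`, with Mellin transform `1 / (s +
N - r)`. -/
theorem mellin_truncated_succ (hc : ContinuousOn f (Ioi 0))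
    (hd : f =O[atTop] fun t => Real.exp (-1 * t)) (he : HasExpansion r f a)
    {N : ℕ} {s : ℂ} (hs : (r : ℝ) - N < s.re) :
    mellin (truncated r f a N) s
      = mellin (truncated r f a (N + 1)) s + a N / (s + ((N : ℂ) - r)) := by
  have h1 := mellinConvergent_truncated hc hd he (N := N + 1) (s := s) (by push_cast; linarith)
  have h2 := hasMellin_cpow_Ioc ((N : ℂ) - r) (s := s) (by simp; linarith)
  have h3 := hasMellin_add h1 (h2.1.const_smul (a N))
  rw [mellin_const_smul, h2.2] at h3
  have : (fun t => truncated r f a (N + 1) t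
      + a N • (Ioc (0 : ℝ) 1).indicator (fun t : ℝ => (t : ℂ) ^ ((N : ℂ) - r)) t)
      = truncated r f a N := by
    funext t
    simp only [truncated, Finset.sum_range_succ]
    ring
  rw [this] at h3
  rw [h3.2]
  simp [div_eq_mul_inv]

/-- The continuation of `mellin f / Gamma` to `r - N < Re s`. -/
def mellinPart (r : ℕ) (f : ℝ → ℂ) (a : ℕ → ℂ) (N : ℕ) (s : ℂ) : ℂ :=
  (Complex.Gamma s)⁻¹ * mellin (truncated r f a N) s
    + ∑ j ∈ Finset.range N, a j * invGammaPart r j s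

theorem mellinPart_eq (hc : ContinuousOn f (Ioi 0))
    (hd : f =O[atTop] fun t => Real.exp (-1 * t)) (he : HasExpansion r f a)
    {N M : ℕ} (hNM : N ≤ M) {s : ℂ} (hs : (r : ℝ) - N < s.re) (h0 : s ∈ poleFree r) :
    mellinPart r f a N s = mellinPart r f a M s := by
  induction M, hNM using Nat.le_induction with
  | base => rfl
  | succ M hM ih =>
    have hs' : (r : ℝ) - M < s.re := by
      have : (N : ℝ) ≤ M := by exact_mod_cast hM
      linarith
    rw [ih, mellinPart, mellinPart, mellin_truncated_succ hc hd he hs', Finset.sum_range_succ]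
    have hne : s + ((M : ℂ) - r) ≠ 0 := by
      intro h
      have := congrArg Complex.re h
      simp at this
      linarith
    rw [← invGammaPart_mul (j := M) (fun h => add_sub_ne_zero_of_mem_poleFree h0 h)]
    field_simp
    ring

theorem differentiableAt_mellinPart (hc : ContinuousOn f (Ioi 0))
    (hd : f =O[atTop] fun t => Real.exp (-1 * t)) (he : HasExpansion r f a)
    {N : ℕ} {s : ℂ} (hs : (r : ℝ) - N < s.re) (h0 : s ∈ poleFree r) :
    DifferentiableAt ℂ (mellinPart r f a N) s := by
  unfold mellinPart
  refine ((Complex.differentiable_one_div_Gamma s).mul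
    (differentiableAt_mellin_truncated hc hd he hs)).add ?_
  refine DifferentiableAt.fun_sum fun j _ => ?_
  exact (differentiableAt_invGammaPart fun h => add_sub_ne_zero_of_mem_poleFree h0 h).const_mul _

theorem isOpen_poleFree (r : ℕ) : IsOpen (poleFree r) := by
  have : poleFree r = ⋂ k ∈ Finset.Icc 1 r, {s : ℂ | s ≠ (k : ℂ)} := by ext; simp
  rw [this]
  exact isOpen_biInter_finset fun k _ => isOpen_ne

/-- By `mellinPart_eq` the continuations for different `N` agree on overlaps, so they glue to one
function, evaluated at each `s` with a sufficiently large `N`. At `s = 0` the factor `1 / Γ` kills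
the Mellin integral. -/
theorem exists_mellin_continuation (hc : ContinuousOn f (Ioi 0))
    (hd : f =O[atTop] fun t => Real.exp (-1 * t)) (he : HasExpansion r f a) :
    ∃ Z : ℂ → ℂ, DifferentiableOn ℂ Z (poleFree r) ∧
      (∀ s : ℂ, (r : ℝ) < s.re → Z s = (Complex.Gamma s)⁻¹ * mellin f s) ∧ Z 0 = a r := by
  let K : ℂ → ℕ := fun s => ⌊(r : ℝ) - s.re⌋₊ + 1
  have hK : ∀ s : ℂ, (r : ℝ) - K s < s.re := by
    intro s
    have := Nat.lt_floor_add_one ((r : ℝ) - s.re)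
    simp only [K]
    push_cast
    linarith
  have hZ : ∀ (N : ℕ) (s : ℂ), (r : ℝ) - N < s.re → s ∈ poleFree r →
      mellinPart r f a (K s) s = mellinPart r f a N s := by
    intro N s hs h0
    rcases le_total N (K s) with h | h
    · exact (mellinPart_eq hc hd he h hs h0).symm
    · exact mellinPart_eq hc hd he h (hK s) h0
  refine ⟨fun s => mellinPart r f a (K s) s, ?_, ?_, ?_⟩
  · intro s hs
    refine DifferentiableAt.differentiableWithinAt ?_
    refine (differentiableAt_mellinPart hc hd he (hK s) hs).congr_of_eventuallyEq ?_
    have h1 : {w : ℂ | (r : ℝ) - K s < w.re} ∈ 𝓝 s :=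
      (isOpen_lt continuous_const Complex.continuous_re).mem_nhds (hK s)
    filter_upwards [h1, (isOpen_poleFree r).mem_nhds hs] with w hw hw'
    exact hZ _ w hw hw'
  · intro s hs
    have h0 : s ∈ poleFree r := by
      rintro k hk rfl
      have : k ≤ r := (Finset.mem_Icc.mp hk).2
      simp at hs
      omega
    have h := hZ 0 s (by simpa using hs) h0
    have h1 : truncated r f a 0 = f := by funext t; simp [truncated]
    simp only [h]
    simp [mellinPart, h1]
  -- `r + 1` terms suffice: the half plane `Re s > -1` contains `0`.
  · have h := hZ (r + 1) 0 (by simp) (zero_mem_poleFree r)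
    simp only [h]
    simp [mellinPart, invGammaPart_zero]

end

end GenSine

/-! ### Dirichlet-type series as Mellin transforms of exponential sums -/

namespace GenSine

open Filter Topology MeasureTheory Set Asymptotics

theorem norm_cpow_mul_exp_neg {s x : ℂ} {t : ℝ} (ht : 0 < t) :
    ‖(t : ℂ) ^ (s - 1) * Complex.exp (-(x * t))‖ = t ^ (s.re - 1) * Real.exp (-(x.re * t)) := by
  rw [norm_mul, Complex.norm_cpow_eq_rpow_re_of_pos ht, Complex.norm_exp]
  simp

theorem continuousOn_cpow_mul_exp_neg (s x : ℂ) :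
    ContinuousOn (fun t : ℝ => (t : ℂ) ^ (s - 1) * Complex.exp (-(x * t))) (Ioi 0) := by
  intro t ht
  refine ContinuousAt.continuousWithinAt ?_
  refine (Complex.continuousAt_ofReal_cpow_const _ _ (Or.inr (ne_of_gt ht))).mul ?_
  fun_prop

theorem integrableOn_rpow_mul_exp_neg {σ y : ℝ} (hσ : 0 < σ) (hy : 0 < y) :
    IntegrableOn (fun t : ℝ => t ^ (σ - 1) * Real.exp (-(y * t))) (Ioi 0) := by
  have := integrableOn_rpow_mul_exp_neg_mul_rpow (s := σ - 1) (p := 1) (b := y)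
    (by linarith) one_pos hy
  simpa [neg_mul] using this

theorem integrableOn_cpow_mul_exp_neg {s x : ℂ} (hs : 0 < s.re) (hx : 0 < x.re) :
    IntegrableOn (fun t : ℝ => (t : ℂ) ^ (s - 1) * Complex.exp (-(x * t))) (Ioi 0) := by
  refine (integrableOn_rpow_mul_exp_neg hs hx).mono'
    ((continuousOn_cpow_mul_exp_neg s x).aestronglyMeasurable measurableSet_Ioi) ?_
  refine (ae_restrict_iff' measurableSet_Ioi).mpr (ae_of_all _ fun t ht => ?_)
  exact (norm_cpow_mul_exp_neg ht).le

theorem integral_norm_cpow_mul_exp_neg {s x : ℂ} (hs : 0 < s.re) (hx : 0 < x.re) :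
    ∫ t in Ioi (0 : ℝ), ‖(t : ℂ) ^ (s - 1) * Complex.exp (-(x * t))‖
      = x.re ^ (-s.re) * Real.Gamma s.re := by
  rw [setIntegral_congr_fun measurableSet_Ioi fun t ht => norm_cpow_mul_exp_neg ht,
    Real.integral_rpow_mul_exp_neg_mul_Ioi hs hx, one_div, Real.inv_rpow hx.le,
    Real.rpow_neg hx.le]

theorem differentiableAt_integral_cpow_mul_exp_neg {s x : ℂ} (hs : 0 < s.re) (hx : 0 < x.re) :
    DifferentiableAt ℂ
      (fun x : ℂ => ∫ t in Ioi (0 : ℝ), (t : ℂ) ^ (s - 1) * Complex.exp (-(x * t))) x := by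
  -- On this ball `Re w > Re x / 2`, which gives one integrable majorant for all derivatives in `w`.
  have hball : ∀ w ∈ Metric.ball x (x.re / 2), x.re / 2 < w.re := by
    intro w hw
    have h1 := (Complex.abs_re_le_norm (w - x)).trans_lt (mem_ball_iff_norm.mp hw)
    have := (abs_lt.mp h1).1
    simp at this
    linarith
  have h := hasDerivAt_integral_of_dominated_loc_of_deriv_le
    (μ := volume.restrict (Ioi (0 : ℝ))) (x₀ := x)
    (F := fun (x : ℂ) (t : ℝ) => (t : ℂ) ^ (s - 1) * Complex.exp (-(x * t)))
    (F' := fun (x : ℂ) (t : ℝ) => (t : ℂ) ^ (s - 1) * (Complex.exp (-(x * t)) * -t))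
    (bound := fun t => t ^ ((s.re + 1) - 1) * Real.exp (-(x.re / 2 * t)))
    (Metric.ball_mem_nhds x (half_pos hx))
    (Eventually.of_forall fun w =>
      (continuousOn_cpow_mul_exp_neg s w).aestronglyMeasurable measurableSet_Ioi)
    (integrableOn_cpow_mul_exp_neg hs hx) ?_ ?_
    (integrableOn_rpow_mul_exp_neg (by linarith) (half_pos hx)) ?_
  · exact h.2.differentiableAt
  · refine ContinuousOn.aestronglyMeasurable ?_ measurableSet_Ioi
    have := (continuousOn_cpow_mul_exp_neg s x).mul
      (f := _) (g := fun t : ℝ => -(t : ℂ)) (by fun_prop)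
    refine this.congr fun t _ => by simp only [mul_assoc, Pi.mul_apply]
  · refine (ae_restrict_iff' measurableSet_Ioi).mpr (ae_of_all _ fun t ht w hw => ?_)
    have ht' : (0 : ℝ) < t := ht
    rw [← mul_assoc, norm_mul, norm_cpow_mul_exp_neg ht, norm_neg, Complex.norm_real,
      Real.norm_of_nonneg ht'.le, mul_right_comm,
      show t ^ (s.re + 1 - 1) = t ^ (s.re - 1) * t by
        rw [← Real.rpow_add_one ht'.ne']; ring_nf]
    gcongr
    exact (hball w hw).le
  · refine ae_of_all _ fun t w _ => ?_
    refine HasDerivAt.const_mul _ ?_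
    refine HasDerivAt.cexp ?_
    simpa using! ((hasDerivAt_id w).mul_const (t : ℂ)).neg

/-- Euler's integral is known for real positive `x`. Both sides are analytic in `x` on the right
half plane, so the identity theorem extends it. -/
theorem integral_cpow_mul_exp_neg_mul_complex {s x : ℂ} (hs : 0 < s.re) (hx : 0 < x.re) :
    ∫ t in Ioi (0 : ℝ), (t : ℂ) ^ (s - 1) * Complex.exp (-(x * t))
      = Complex.exp (-s * Complex.log x) * Complex.Gamma s := by
  have hU : IsOpen {x : ℂ | 0 < x.re} := isOpen_lt continuous_const Complex.continuous_re
  have h1 : AnalyticOnNhd ℂ (fun x : ℂ =>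
      ∫ t in Ioi (0 : ℝ), (t : ℂ) ^ (s - 1) * Complex.exp (-(x * t))) {x : ℂ | 0 < x.re} :=
    DifferentiableOn.analyticOnNhd (fun x hx =>
      (differentiableAt_integral_cpow_mul_exp_neg hs hx).differentiableWithinAt) hU
  have h2 : AnalyticOnNhd ℂ (fun x : ℂ => Complex.exp (-s * Complex.log x) * Complex.Gamma s)
      {x : ℂ | 0 < x.re} := by
    refine DifferentiableOn.analyticOnNhd (fun x hx => ?_) hU
    have : DifferentiableAt ℂ Complex.log x := Complex.differentiableAt_log (Or.inl hx)
    exact ((this.const_mul _).cexp.mul_const _).differentiableWithinAt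
  have hconn : IsPreconnected {x : ℂ | 0 < x.re} :=
    (convex_halfSpace_re_gt 0).isPreconnected
  refine h1.eqOn_of_preconnected_of_frequently_eq h2 hconn (z₀ := 1) (by simp) ?_ hx
  have hfreq : ∃ᶠ y : ℝ in 𝓝[≠] 1, 0 < y :=
    (eventually_nhdsWithin_of_eventually_nhds (eventually_gt_nhds zero_lt_one)).frequently
  have htend : Tendsto (fun y : ℝ => (y : ℂ)) (𝓝[≠] 1) (𝓝[≠] 1) := by
    refine tendsto_nhdsWithin_of_tendsto_nhds_of_eventually_within _ ?_ ?_
    · exact (Complex.continuous_ofReal.tendsto' 1 1 (by simp)).mono_left nhdsWithin_le_nhds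
    · filter_upwards [self_mem_nhdsWithin] with y hy
      simpa using hy
  refine htend.frequently (hfreq.mono fun y hy => ?_)
  rw [Complex.integral_cpow_mul_exp_neg_mul_Ioi hs hy, one_div,
    Complex.inv_cpow _ _ (by rw [Complex.arg_ofReal_of_nonneg hy.le]; exact Real.pi_pos.ne),
    Complex.cpow_def_of_ne_zero (by exact_mod_cast hy.ne'), ← Complex.exp_neg]
  ring_nf

/-- Sum and integral are interchanged: the `L¹` norms of the terms are `(Re x_i)^(-Re s) Γ(Re s)`,
summable by assumption. -/
theorem hasSum_mellin_exp {ι : Type*} [Countable ι] {x : ι → ℂ} (hx : ∀ i, 0 < (x i).re) {s : ℂ}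
    (hs : 0 < s.re) (hsum : Summable fun i => (x i).re ^ (-s.re)) :
    HasSum (fun i => Complex.exp (-s * Complex.log (x i)))
      ((Complex.Gamma s)⁻¹ * mellin (fun t : ℝ => ∑' i, Complex.exp (-(x i * t))) s) := by
  have h := hasSum_integral_of_summable_integral_norm (μ := volume.restrict (Ioi (0 : ℝ)))
    (F := fun i (t : ℝ) => (t : ℂ) ^ (s - 1) * Complex.exp (-(x i * t)))
    (fun i => integrableOn_cpow_mul_exp_neg hs (hx i))
    (by simpa only [integral_norm_cpow_mul_exp_neg hs (hx _)] using hsum.mul_right _)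
  simp only [integral_cpow_mul_exp_neg_mul_complex hs (hx _), tsum_mul_left] at h
  have hG : Complex.Gamma s ≠ 0 := Complex.Gamma_ne_zero_of_re_pos hs
  convert! h.mul_left (Complex.Gamma s)⁻¹ using 2 with i
  field_simp

theorem HasExpansion.congr {r : ℕ} {f g : ℝ → ℂ} {a : ℕ → ℂ} (hf : HasExpansion r f a)
    (h : f =ᶠ[𝓝[>] 0] g) : HasExpansion r g a := by
  intro N
  refine (hf N).congr' ?_ EventuallyEq.rfl
  filter_upwards [h] with t ht
  rw [ht]

theorem HasExpansion.sub {r : ℕ} {f g : ℝ → ℂ} {a b : ℕ → ℂ} (hf : HasExpansion r f a)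
    (hg : HasExpansion r g b) : HasExpansion r (fun t => f t - g t) (fun j => a j - b j) := by
  intro N
  refine ((hf N).sub (hg N)).congr_left fun t => ?_
  simp only [sub_mul, Finset.sum_sub_distrib]
  ring

theorem HasExpansion.sum {r : ℕ} {ι : Type*} (B : Finset ι) {f : ι → ℝ → ℂ} {a : ι → ℕ → ℂ}
    (hf : ∀ i ∈ B, HasExpansion r (f i) (a i)) :
    HasExpansion r (fun t => ∑ i ∈ B, f i t) (fun j => ∑ i ∈ B, a i j) := by
  intro N
  refine (IsBigO.fun_sum fun i hi => hf i hi N).congr_left fun t => ?_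
  simp only [Finset.sum_sub_distrib, Finset.sum_mul]
  rw [Finset.sum_comm]

/-- The expansion of `t ↦ h (ε t) / t^r` from the power series of `h`. -/
theorem hasExpansion_of_hasFPowerSeriesAt (r : ℕ) {h : ℂ → ℂ}
    {p : FormalMultilinearSeries ℂ ℂ ℂ} (hp : HasFPowerSeriesAt h p 0) (ε : ℂ) :
    HasExpansion r (fun t => h (ε * t) / (t : ℂ) ^ r) (fun j => ε ^ j * p.coeff j) := by
  intro N
  have h1 := hp.isBigO_sub_partialSum_pow N
  have h2 : Tendsto (fun t : ℝ => ε * (t : ℂ)) (𝓝[>] 0) (𝓝 0) := by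
    refine Tendsto.mono_left ?_ nhdsWithin_le_nhds
    exact Continuous.tendsto' (by fun_prop) _ _ (by simp)
  have h3 := h1.comp_tendsto h2
  have h4 : (fun t : ℝ => ‖ε * (t : ℂ)‖ ^ N) =O[𝓝[>] 0] fun t : ℝ => t ^ N := by
    refine IsBigO.of_bound (‖ε‖ ^ N) (Eventually.of_forall fun t => ?_)
    simp [mul_pow]
  have h5 : (fun t : ℝ => (((t : ℝ) ^ r)⁻¹ : ℂ)) =O[𝓝[>] 0] fun t : ℝ => (t ^ r)⁻¹ :=
    IsBigO.of_bound 1 (Eventually.of_forall fun t => by simp)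
  have h6 := h5.mul (h3.trans h4)
  refine h6.congr' ?_ ?_
  · filter_upwards [self_mem_nhdsWithin] with t ht
    have ht0 : (t : ℂ) ≠ 0 := by exact_mod_cast (ne_of_gt ht : t ≠ 0)
    simp only [Function.comp_apply, zero_add, FormalMultilinearSeries.partialSum,
      FormalMultilinearSeries.apply_eq_pow_smul_coeff, smul_eq_mul, mul_sub, Finset.mul_sum]
    congr 1
    · rw [div_eq_mul_inv, mul_comm]
    · refine Finset.sum_congr rfl fun j _ => ?_
      rw [Complex.cpow_sub _ _ ht0, Complex.cpow_natCast, Complex.cpow_natCast, mul_pow]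
      field_simp
  · filter_upwards [self_mem_nhdsWithin] with t ht
    rw [Real.rpow_sub ht, Real.rpow_natCast, Real.rpow_natCast, div_eq_mul_inv, mul_comm]

theorem HasExpansion.shift {r : ℕ} {g : ℝ → ℂ} {b : ℕ → ℂ} (hg : HasExpansion 0 g b) :
    HasExpansion r g (fun j => if j < r then 0 else b (j - r)) := by
  intro N
  -- For `N ≤ r` only zero coefficients are subtracted, and a bounded function is `O(t^(N - r))`
  -- near `0`.
  rcases le_total N r with hN | hN
  · have h0 := hg 0
    have h1 : (fun t : ℝ => t ^ (((0 : ℕ) : ℝ) - ((0 : ℕ) : ℝ))) =O[𝓝[>] 0]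
        fun t : ℝ => t ^ ((N : ℝ) - r) := by
      refine IsBigO.of_bound 1 ?_
      filter_upwards [Ioc_mem_nhdsGT (zero_lt_one' ℝ)] with t ht
      simp only [sub_self, Real.rpow_zero, norm_one, one_mul]
      rw [Real.norm_of_nonneg (Real.rpow_nonneg ht.1.le _)]
      refine Real.one_le_rpow_of_pos_of_le_one_of_nonpos ht.1 ht.2 ?_
      have : (N : ℝ) ≤ r := by exact_mod_cast hN
      linarith
    refine (h0.trans h1).congr_left fun t => ?_
    rw [Finset.sum_eq_zero (s := Finset.range N)]
    · simp
    · intro j hj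
      simp only [if_pos (lt_of_lt_of_le (Finset.mem_range.mp hj) hN), zero_mul]
  · obtain ⟨n, rfl⟩ := Nat.exists_eq_add_of_le hN
    refine (hg n).congr (fun t => ?_) fun t => ?_
    · rw [Finset.sum_range_add, Finset.sum_eq_zero (s := Finset.range r), zero_add]
      · congr 1
        refine Finset.sum_congr rfl fun j _ => ?_
        simp
      · intro j hj
        simp only [if_pos (Finset.mem_range.mp hj), zero_mul]
    · push_cast
      ring_nf

/-- A single exponential contributes `1` to the constant coefficient, just as a single term `x^(-s)`
contributes `1` at `s = 0`. -/
theorem hasExpansion_exp (r : ℕ) (x : ℂ) :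
    ∃ a : ℕ → ℂ, HasExpansion r (fun t => Complex.exp (-(x * t))) a ∧ a r = 1 := by
  have han : AnalyticAt ℂ (fun t : ℂ => Complex.exp (-(x * t))) 0 := by fun_prop
  obtain ⟨p, hp⟩ := han
  have h := (hasExpansion_of_hasFPowerSeriesAt 0 hp 1).shift (r := r)
  refine ⟨_, h.congr (Eventually.of_forall fun t => by simp), ?_⟩
  simp only [lt_irrefl, if_false, tsub_self, pow_zero, one_mul]
  rw [FormalMultilinearSeries.coeff]
  simpa using (hp.coeff_zero 1)

/-- From `x^m / m! ≤ e^x`; it deduces convergence of exponential sums from that of power sums. -/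
theorem exp_neg_le_rpow (m : ℕ) {ε y : ℝ} (hε : 0 < ε) (hy : 0 < y) :
    Real.exp (-(y * ε)) ≤ m.factorial / ε ^ m * y ^ (-(m : ℝ)) := by
  have h := Real.pow_div_factorial_le_exp (x := y * ε) (by positivity) m
  rw [Real.exp_neg, Real.rpow_neg hy.le, Real.rpow_natCast, ← div_eq_mul_inv, div_div, ← mul_pow,
    mul_comm ε]
  rw [inv_le_comm₀ (Real.exp_pos _) (by positivity), inv_div]
  exact h

section

variable {ι : Type*} {x : ι → ℂ} {r : ℕ}

theorem summable_exp_neg (hx : ∀ i, 0 < (x i).re)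
    (hsum : ∀ σ : ℝ, r < σ → Summable fun i => (x i).re ^ (-σ)) {ε : ℝ} (hε : 0 < ε) :
    Summable fun i => Real.exp (-((x i).re * ε)) := by
  refine Summable.of_nonneg_of_le (fun i => (Real.exp_pos _).le)
    (fun i => exp_neg_le_rpow (r + 1) hε (hx i)) ((hsum _ ?_).mul_left _)
  push_cast
  linarith

theorem exists_zeta_of_one_le_re [Countable ι] (hx : ∀ i, 1 ≤ (x i).re)
    (hsum : ∀ σ : ℝ, r < σ → Summable fun i => (x i).re ^ (-σ)) {a : ℕ → ℂ}
    (he : HasExpansion r (fun t : ℝ => ∑' i, Complex.exp (-(x i * t))) a) :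
    ∃ Z : ℂ → ℂ, DifferentiableOn ℂ Z (poleFree r) ∧
      (∀ s : ℂ, (r : ℝ) < s.re → HasSum (fun i => Complex.exp (-s * Complex.log (x i))) (Z s)) ∧
      Z 0 = a r := by
  have hx0 : ∀ i, 0 < (x i).re := fun i => one_pos.trans_le (hx i)
  have hnorm : ∀ i (t : ℝ), ‖Complex.exp (-(x i * t))‖ = Real.exp (-((x i).re * t)) := by
    intro i t
    rw [Complex.norm_exp]
    simp
  have hc : ContinuousOn (fun t : ℝ => ∑' i, Complex.exp (-(x i * t))) (Ioi 0) := by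
    intro t ht
    have ht2 : (0 : ℝ) < t / 2 := half_pos ht
    have : ContinuousOn (fun t : ℝ => ∑' i, Complex.exp (-(x i * t))) (Ioi (t / 2)) := by
      refine continuousOn_tsum (fun i => by fun_prop) (summable_exp_neg hx0 hsum ht2) ?_
      intro i u hu
      rw [hnorm]
      have := hx0 i
      have hu' : t / 2 < u := hu
      gcongr
    exact (this.continuousAt (Ioi_mem_nhds (half_lt_self ht))).continuousWithinAt
  have hd : (fun t : ℝ => ∑' i, Complex.exp (-(x i * t)))
      =O[atTop] fun t => Real.exp (-1 * t) := by
    refine IsBigO.of_bound (Real.exp 1 * ∑' i, Real.exp (-((x i).re * 1))) ?_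
    filter_upwards [eventually_ge_atTop 1] with t ht
    have hs1 := summable_exp_neg hx0 hsum one_pos
    rw [Real.norm_of_nonneg (Real.exp_pos _).le, mul_right_comm, ← tsum_mul_left]
    refine tsum_of_norm_bounded (hs1.mul_left _).hasSum fun i => ?_
    rw [hnorm, ← Real.exp_add, ← Real.exp_add]
    -- The inequality of exponents is `0 ≤ (Re x_i - 1) (t - 1)`.
    refine Real.exp_le_exp.mpr ?_
    nlinarith [mul_nonneg (sub_nonneg.mpr (hx i)) (sub_nonneg.mpr ht)]
  obtain ⟨Z, h1, h2, h3⟩ := exists_mellin_continuation hc hd he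
  refine ⟨Z, h1, fun s hs => ?_, h3⟩
  rw [h2 s hs]
  exact hasSum_mellin_exp hx0 ((Nat.cast_nonneg r).trans_lt hs) (hsum _ hs)

/-- The finitely many terms in `B` may lie outside the right half plane. Their exponentials are
subtracted from `f`, and their powers, entire in `s` whatever the logarithm, are added back. Each
changes the coefficient and the value at `0` by the same `1`. -/
theorem exists_zeta_of_hasExpansion [Countable ι] (B : Finset ι) (hB : ∀ i ∉ B, 1 ≤ (x i).re)
    (hsum : ∀ σ : ℝ, r < σ → Summable fun i : {i // i ∉ B} => (x i).re ^ (-σ))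
    {f : ℝ → ℂ} {a : ℕ → ℂ} (he : HasExpansion r f a)
    (hf : ∀ᶠ t : ℝ in 𝓝[>] 0, HasSum (fun i => Complex.exp (-(x i * t))) (f t)) :
    ∃ Z : ℂ → ℂ, DifferentiableOn ℂ Z (poleFree r) ∧
      (∀ s : ℂ, (r : ℝ) < s.re → HasSum (fun i => Complex.exp (-s * Complex.log (x i))) (Z s)) ∧
      Z 0 = a r := by
  choose b hb hb1 using fun i => hasExpansion_exp r (x i)
  have he' := (he.sub (HasExpansion.sum B fun i _ => hb i)).congr
    (g := fun t : ℝ => ∑' i : {i // i ∉ B}, Complex.exp (-(x i * t))) (by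
      filter_upwards [hf] with t ht
      refine (HasSum.tsum_eq ?_).symm
      rw [B.hasSum_compl_iff (f := fun i => Complex.exp (-(x i * t)))]
      simpa using ht)
  obtain ⟨Z, h1, h2, h3⟩ := exists_zeta_of_one_le_re (x := fun i : {i // i ∉ B} => x i)
    (fun i => hB i i.2) hsum he'
  refine ⟨fun s => Z s + ∑ i ∈ B, Complex.exp (-s * Complex.log (x i)),
    ?_, fun s hs => ?_, ?_⟩
  · refine DifferentiableOn.add h1 ?_
    fun_prop
  · exact (B.hasSum_compl_iff (f := fun i => Complex.exp (-s * Complex.log (x i)))).mp (h2 s hs)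
  · simp [h3, hb1]

end

end GenSine

/-! ### Zeta functions over lattice points and the reciprocity relation -/

namespace GenSine

open Filter Topology Set

variable {r : ℕ}

/-- The complex number `n · ω`. -/
def pairing (ω : Fin r → ℂ) (n : Fin r → ℤ) : ℂ := ∑ j, (n j : ℂ) * ω j

theorem shifted_eq (ω : Fin r → ℂ) (z : ℂ) (n : Fin r → ℤ) :
    shifted ω z n = z + pairing ω n := rfl

theorem pairing_sub (ω : Fin r → ℂ) (n m : Fin r → ℤ) :
    pairing ω (n - m) = pairing ω n - pairing ω m := by
  simp [pairing, sub_mul, Finset.sum_sub_distrib]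

theorem pairing_sum (ω : Fin r → ℂ) {ι : Type*} (s : Finset ι) (w : ι → Fin r → ℤ) :
    pairing ω (∑ i ∈ s, w i) = ∑ i ∈ s, pairing ω (w i) := by
  simp only [pairing, Finset.sum_apply, Int.cast_sum, Finset.sum_mul]
  exact Finset.sum_comm

theorem pairing_const_mul (ω : Fin r → ℂ) (c : ℂ) (n : Fin r → ℤ) :
    pairing (fun j => c * ω j) n = c * pairing ω n := by
  simp only [pairing, Finset.mul_sum]
  exact Finset.sum_congr rfl fun j _ => by ring

theorem pairing_re (ω : Fin r → ℂ) (n : Fin r → ℤ) :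
    (pairing ω n).re = (fun j => (ω j).re) ⬝ᵥ toReal n := by
  simp [pairing, dotProduct, toReal, mul_comm]

theorem norm_toReal (n : Fin r → ℤ) : ‖toReal n‖ = ‖n‖ := by
  rw [Pi.norm_def, Pi.norm_def]
  exact congrArg NNReal.toReal (Finset.sup_congr rfl fun b _ => NNReal.eq (Int.norm_cast_real _))

theorem toReal_injective : Function.Injective (toReal : (Fin r → ℤ) → Fin r → ℝ) := by
  intro n m h
  funext j
  exact Int.cast_injective (congrFun h j)

theorem exists_pos_mul_norm_le {S : Set (Fin r → ℝ)} {η : Fin r → ℝ}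
    (hη : η ∈ interior (dualCone S)) : ∃ δ > 0, ∀ u ∈ S, δ * ‖u‖ ≤ η ⬝ᵥ u := by
  obtain ⟨ε, hε, hball⟩ := Metric.mem_nhds_iff.mp (mem_interior_iff_mem_nhds.mp hη)
  refine ⟨ε / 2, half_pos hε, fun u hu => ?_⟩
  -- Perturbing `η` by `ε/2` times the signs of `u` bounds `η ⬝ᵥ u` below by `ε/2` times the `ℓ¹`
  -- norm of `u`, which dominates the sup norm.
  let y : Fin r → ℝ := fun j => ε / 2 * SignType.sign (u j)
  have hy : η - y ∈ dualCone S := by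
    apply hball
    rw [mem_ball_iff_norm, sub_sub_cancel_left, norm_neg]
    refine lt_of_le_of_lt ((pi_norm_le_iff_of_nonneg (half_pos hε).le).mpr fun j => ?_)
      (half_lt_self hε)
    simp only [y, norm_mul, Real.norm_of_nonneg (half_pos hε).le]
    refine mul_le_of_le_one_right (half_pos hε).le ?_
    rcases lt_trichotomy (u j) 0 with h | h | h <;> simp [h]
  have h1 := hy u hu
  rw [sub_dotProduct, sub_nonneg] at h1
  refine le_trans ?_ h1
  have h2 : y ⬝ᵥ u = ε / 2 * ∑ j, |u j| := by
    simp only [dotProduct, y, Finset.mul_sum]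
    refine Finset.sum_congr rfl fun j _ => ?_
    rw [mul_assoc, sign_mul_self]
  rw [h2]
  refine mul_le_mul_of_nonneg_left ?_ (half_pos hε).le
  refine (pi_norm_le_iff_of_nonneg (Finset.sum_nonneg fun j _ => abs_nonneg _)).mpr fun j => ?_
  exact Finset.single_le_sum (f := fun j => |u j|) (fun j _ => abs_nonneg _) (Finset.mem_univ j)

theorem summable_norm_rpow {σ : ℝ} (hσ : r < σ) :
    Summable fun n : Fin r → ℤ => ‖toReal n‖ ^ (-σ) := by
  let b := Pi.basisFun ℝ (Fin r)
  let L : Submodule ℤ (Fin r → ℝ) := Submodule.span ℤ (Set.range b)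
  have hfr : Module.finrank ℤ L = r := by
    rw [ZLattice.rank ℝ L]
    simp
  have hmem : ∀ n : Fin r → ℤ, toReal n ∈ L := by
    intro n
    have : toReal n = ∑ j, n j • b j := by
      funext i
      simp [toReal, b, Pi.basisFun_apply, Finset.sum_apply, Pi.single_apply]
    rw [this]
    exact Submodule.sum_mem _ fun j _ =>
      Submodule.smul_mem _ _ (Submodule.subset_span (Set.mem_range_self j))
  have h := ZLattice.summable_norm_rpow L (-σ) (by rw [hfr]; linarith)
  exact h.comp_injective (i := fun n => (⟨toReal n, hmem n⟩ : L)) fun n m hnm =>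
    toReal_injective (congrArg Subtype.val hnm)

theorem finite_norm_toReal_le (R : ℝ) : {n : Fin r → ℤ | ‖toReal n‖ ≤ R}.Finite := by
  have h := (isCompact_closedBall (0 : Fin r → ℤ) R).finite_of_discrete
  refine h.subset fun n hn => ?_
  rw [mem_closedBall_zero_iff, ← norm_toReal]
  exact hn

/-- The vector `e^{-iθ} ω`. -/
abbrev rotated (θ : ℝ) (ω : Fin r → ℂ) : Fin r → ℂ :=
  fun j => Complex.exp (-(θ * Complex.I)) * ω j

theorem rotated_shifted (θ : ℝ) (ω : Fin r → ℂ) (z : ℂ) (n : Fin r → ℤ) :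
    Complex.exp (-(θ * Complex.I)) * shifted ω z n
      = Complex.exp (-(θ * Complex.I)) * z + pairing (rotated θ ω) n := by
  rw [shifted_eq, mul_add, pairing_const_mul]

/-- The real vector `Re (e^{-iθ} ω)`. -/
abbrev rotatedRe (θ : ℝ) (ω : Fin r → ℂ) : Fin r → ℝ :=
  fun j => (Complex.exp (-(θ * Complex.I)) * ω j).re

theorem le_re_rotated_shifted {S : Set (Fin r → ℝ)} {θ δ : ℝ} {ω : Fin r → ℂ}
    (hS : ∀ u ∈ S, δ * ‖u‖ ≤ rotatedRe θ ω ⬝ᵥ u) (z : ℂ) {n : Fin r → ℤ}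
    (hn : n ∈ latticePoints S) :
    δ * ‖toReal n‖ - ‖z‖ ≤ (Complex.exp (-(θ * Complex.I)) * shifted ω z n).re := by
  rw [rotated_shifted, Complex.add_re, pairing_re]
  have h1 := hS _ hn
  have h2 := (abs_le.mp (Complex.abs_re_le_norm (Complex.exp (-(θ * Complex.I)) * z))).1
  have h3 : ‖Complex.exp (-(θ * Complex.I)) * z‖ = ‖z‖ := by
    rw [norm_mul, Complex.norm_exp]
    simp
  rw [h3] at h2
  linarith

theorem finite_re_rotated_shifted_lt {S : Set (Fin r → ℝ)} {θ δ : ℝ} (hδ : 0 < δ)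
    {ω : Fin r → ℂ} (hS : ∀ u ∈ S, δ * ‖u‖ ≤ rotatedRe θ ω ⬝ᵥ u) (z : ℂ) :
    {n : latticePoints S | (Complex.exp (-(θ * Complex.I)) * shifted ω z n).re < 1}.Finite := by
  refine Set.Finite.of_finite_image
    ((finite_norm_toReal_le ((1 + ‖z‖) / δ)).subset ?_) Subtype.val_injective.injOn
  rintro _ ⟨n, hn, rfl⟩
  have := le_re_rotated_shifted hS z n.2
  simp only [mem_ofPred_eq] at hn ⊢
  rw [le_div_iff₀ hδ]
  linarith

/-- Rotation by `e^{-iθ}` moves all but finitely many terms to `Re ≥ 1`. The branch at `θ` and the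
principal branch of the rotated number differ by `iθ`, hence the factor `e^{-isθ}`, which is `1` at
`s = 0`. -/
theorem exists_isZeta {S : Set (Fin r → ℝ)} {θ δ : ℝ} (hδ : 0 < δ) {ω : Fin r → ℂ}
    (hS : ∀ u ∈ S, δ * ‖u‖ ≤ rotatedRe θ ω ⬝ᵥ u) (z : ℂ) {f : ℝ → ℂ} {a : ℕ → ℂ}
    (he : HasExpansion r f a)
    (hf : ∀ᶠ t : ℝ in 𝓝[>] 0, HasSum (fun n : latticePoints S =>
      Complex.exp (-(Complex.exp (-(θ * Complex.I)) * shifted ω z n * t))) (f t)) :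
    ∃ Z : ℂ → ℂ, IsZeta S θ ω z Z ∧ Z 0 = a r := by
  classical
  let x : latticePoints S → ℂ := fun n => Complex.exp (-(θ * Complex.I)) * shifted ω z n
  have hfin := finite_re_rotated_shifted_lt hδ hS z
  have hfin0 : {n : latticePoints S | (n : Fin r → ℤ) = 0}.Finite :=
    Set.Subsingleton.finite fun n hn m hm => Subtype.ext (hn.trans hm.symm)
  -- The origin is excluded as well, because the comparison is with `‖n‖^(-σ)`.
  let B : Finset (latticePoints S) := hfin.toFinset ∪ hfin0.toFinset
  have hB : ∀ n ∉ B, 1 ≤ (x n).re ∧ (n : Fin r → ℤ) ≠ 0 := by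
    intro n hn
    simp only [B, Finset.mem_union, Set.Finite.mem_toFinset, mem_ofPred_eq, not_or, not_lt] at hn
    exact hn
  have hsum : ∀ σ : ℝ, r < σ → Summable fun n : {n // n ∉ B} => (x n).re ^ (-σ) := by
    intro σ hσ
    have h1 : Summable fun n : {n // n ∉ B} => ‖toReal (n : Fin r → ℤ)‖ ^ (-σ) :=
      (summable_norm_rpow hσ).comp_injective
        (i := fun n : {n // n ∉ B} => ((n : latticePoints S) : Fin r → ℤ))
        (Subtype.val_injective.comp Subtype.val_injective)
    refine Summable.of_nonneg_of_le
      (fun n => Real.rpow_nonneg (zero_le_one.trans (hB n n.2).1) _) (fun n => ?_)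
      -- From `Re x ≥ δ‖n‖ - ‖z‖` and `Re x ≥ 1` follows `(1 + ‖z‖) Re x ≥ δ‖n‖`.
      (h1.mul_left ((δ / (1 + ‖z‖)) ^ (-σ)))
    obtain ⟨h2, h3⟩ := hB n n.2
    have h4 : 0 < ‖toReal (n : Fin r → ℤ)‖ := by
      rw [norm_toReal]
      exact norm_pos_iff.mpr h3
    have h5 : 0 < 1 + ‖z‖ := by positivity
    rw [← Real.mul_rpow (by positivity) (by positivity)]
    refine Real.rpow_le_rpow_of_nonpos (by positivity) ?_ ?_
    · rw [div_mul_eq_mul_div, div_le_iff₀ h5]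
      have := le_re_rotated_shifted hS z (n : latticePoints S).2
      have h6 : 0 ≤ ‖z‖ := norm_nonneg z
      simp only [x] at h2 ⊢
      nlinarith
    · have : (0 : ℝ) ≤ r := Nat.cast_nonneg r
      linarith
  obtain ⟨Z, h1, h2, h3⟩ := exists_zeta_of_hasExpansion (x := x) B (fun n hn => (hB n hn).1)
    hsum he hf
  refine ⟨fun s => Complex.exp (-s * (θ * Complex.I)) * Z s, ⟨?_, fun s hs => ?_⟩, by simp [h3]⟩
  · exact DifferentiableOn.mul (by fun_prop) h1
  · convert! (h2 s hs).mul_left (Complex.exp (-s * (θ * Complex.I))) using 2 with n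
    rw [branchLog, ← Complex.exp_add]
    congr 1
    ring

/-- Weights `a` and `b` on the lattice whose exponential sums `∑ a_n e^{-t n·ω}` and
`∑ b_n e^{-t n·ω}` continue to meromorphic functions `F` and `G` with a pole of order at most `r`
at `0` and `G t = (-1)^r F (-t)`. -/
def Reciprocal (ω : Fin r → ℂ) (a b : (Fin r → ℤ) → ℂ) : Prop :=
  ∃ h : ℂ → ℂ, AnalyticAt ℂ h 0 ∧ ∀ᶠ t : ℝ in 𝓝[>] 0,
    HasSum (fun n => a n * Complex.exp (-(pairing ω n * t))) (h t / (t : ℂ) ^ r) ∧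
    HasSum (fun n => b n * Complex.exp (-(pairing ω n * t))) (h (-t) / (t : ℂ) ^ r)

theorem Reciprocal.add {ω : Fin r → ℂ} {a b a' b' : (Fin r → ℤ) → ℂ}
    (h : Reciprocal ω a b) (h' : Reciprocal ω a' b') : Reciprocal ω (a + a') (b + b') := by
  obtain ⟨f, hf, h1⟩ := h
  obtain ⟨g, hg, h2⟩ := h'
  refine ⟨fun t => f t + g t, hf.fun_add hg, ?_⟩
  filter_upwards [h1, h2] with t h1 h2
  simp only [Pi.add_apply, add_mul, add_div]
  exact ⟨h1.1.add h2.1, h1.2.add h2.2⟩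

theorem Reciprocal.smul {ω : Fin r → ℂ} {a b : (Fin r → ℤ) → ℂ}
    (h : Reciprocal ω a b) (c : ℂ) : Reciprocal ω (c • a) (c • b) := by
  obtain ⟨f, hf, h1⟩ := h
  refine ⟨fun t => c * f t, analyticAt_const.fun_mul hf, ?_⟩
  filter_upwards [h1] with t h1
  simp only [Pi.smul_apply, smul_eq_mul, mul_assoc, mul_div_assoc]
  exact ⟨h1.1.mul_left c, h1.2.mul_left c⟩

theorem Reciprocal.zero (ω : Fin r → ℂ) : Reciprocal ω 0 0 :=
  ⟨fun _ => 0, analyticAt_const, Eventually.of_forall fun t => by simp [hasSum_zero]⟩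

theorem Reciprocal.sum {ω : Fin r → ℂ} {ι : Type*} (s : Finset ι)
    {a b : ι → (Fin r → ℤ) → ℂ} (h : ∀ i ∈ s, Reciprocal ω (a i) (b i)) :
    Reciprocal ω (∑ i ∈ s, a i) (∑ i ∈ s, b i) := by
  classical
  induction s using Finset.induction_on with
  | empty => simpa using Reciprocal.zero ω
  | insert i s hi ih =>
    rw [Finset.sum_insert hi, Finset.sum_insert hi]
    exact (h i (Finset.mem_insert_self _ _)).add
      (ih fun j hj => h j (Finset.mem_insert_of_mem hj))

/-- With `g t = exp (-u z t) h t`, the sums for `S` at `z` and for `T` at `-z` are `g t / t^r` and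
`g (-t) / t^r`. Their constant coefficients are the `r`-th Taylor coefficients of `g t` and `g
(-t)`, which differ by `(-1)^r`. -/
theorem exists_isZeta_of_reciprocal {S T : Set (Fin r → ℝ)} {θ δ : ℝ} (hδ : 0 < δ)
    {ω : Fin r → ℂ} (hS : ∀ u ∈ S, δ * ‖u‖ ≤ rotatedRe θ ω ⬝ᵥ u) (hTS : T ⊆ S)
    (h : Reciprocal (rotated θ ω) ((latticePoints S).indicator 1)
      ((latticePoints T).indicator 1)) (z : ℂ) :
    ∃ Z W : ℂ → ℂ, IsZeta S θ ω z Z ∧ IsZeta T θ ω (-z) W ∧ W 0 = (-1) ^ r * Z 0 := by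
  obtain ⟨h, hh, hs⟩ := h
  set u : ℂ := Complex.exp (-(θ * Complex.I)) with hu
  have hg : AnalyticAt ℂ (fun t => Complex.exp (-(u * z * t)) * h t) 0 := by
    refine AnalyticAt.fun_mul ?_ hh
    fun_prop
  obtain ⟨p, hp⟩ := hg
  have key : ∀ (A : Set (Fin r → ℝ)) (y v : ℂ) (t : ℝ),
      HasSum (fun n => (latticePoints A).indicator 1 n
        * Complex.exp (-(pairing (rotated θ ω) n * t))) v →
      HasSum (fun n : latticePoints A => Complex.exp (-(u * shifted ω y n * t)))
        (Complex.exp (-(u * y * t)) * v) := by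
    intro A y v t hv
    have h1 : HasSum (fun n : latticePoints A =>
        Complex.exp (-(pairing (rotated θ ω) n * t))) v := by
      refine (hasSum_subtype_iff_indicator (s := latticePoints A)
        (f := fun n => Complex.exp (-(pairing (rotated θ ω) n * t)))).mpr ?_
      convert! hv using 2 with n
      by_cases hn : n ∈ latticePoints A <;> simp [hn]
    convert! h1.mul_left (Complex.exp (-(u * y * t))) using 2 with n
    rw [hu, rotated_shifted, ← Complex.exp_add]
    congr 1
    ring
  obtain ⟨Z, hZ, hZ0⟩ := exists_isZeta hδ hS z (hasExpansion_of_hasFPowerSeriesAt r hp 1) (by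
    filter_upwards [hs] with t ht
    convert! key S z _ t ht.1 using 1
    simp only [one_mul]
    ring)
  obtain ⟨W, hW, hW0⟩ := exists_isZeta hδ (fun v hv => hS v (hTS hv)) (-z)
    (hasExpansion_of_hasFPowerSeriesAt r hp (-1)) (by
      filter_upwards [hs] with t ht
      convert! key T (-z) _ t ht.2 using 1
      simp only [neg_mul, one_mul, mul_neg, neg_neg]
      ring)
  exact ⟨Z, W, hZ, hW, by rw [hW0, hZ0]; simp⟩

end GenSine

/-! ### Half-open simplicial cones -/

namespace GenSine

open Filter Topology Set

variable {r k : ℕ}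

theorem summable_exp_neg_norm {ε : ℝ} (hε : 0 < ε) :
    Summable fun n : Fin r → ℤ => Real.exp (-(‖toReal n‖ * ε)) := by
  rw [← Finset.summable_compl_iff {0}]
  have h := (summable_norm_rpow (r := r) (σ := (r + 1 : ℕ)) (by push_cast; linarith)).mul_left
    ((r + 1).factorial / ε ^ (r + 1) : ℝ)
  refine Summable.of_nonneg_of_le (fun n => (Real.exp_pos _).le) (fun n => ?_)
    (h.comp_injective (i := fun n : {n : Fin r → ℤ // n ∉ ({0} : Finset _)} => (n : Fin r → ℤ))
      Subtype.val_injective)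
  refine exp_neg_le_rpow (r + 1) hε ?_
  rw [norm_toReal]
  exact norm_pos_iff.mpr (by simpa using n.2)

/-- The lattice points `∑ c_i w_i` with coordinates `c_i` in `P i`. -/
def piece (w : Fin k → Fin r → ℤ) (P : Fin k → Set ℝ) : Set (Fin r → ℤ) :=
  {n | ∃ c : Fin k → ℝ, (∀ i, c i ∈ P i) ∧ toReal n = ∑ i, c i • toReal (w i)}

theorem toReal_sub (n m : Fin r → ℤ) : toReal (n - m) = toReal n - toReal m := by
  funext j; simp [toReal]

theorem toReal_sum {ι : Type*} (s : Finset ι) (w : ι → Fin r → ℤ) :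
    toReal (∑ i ∈ s, w i) = ∑ i ∈ s, toReal (w i) := by
  funext j; simp [toReal]

/-- The half line `c > 0` (if `b`) or `c ≥ 0`. -/
def halfLine (b : Bool) : Set ℝ := if b then Ioi 0 else Ici 0

/-- The half-open unit interval `(0, 1]` (if `b`) or `[0, 1)`. -/
def halfOpenUnit (b : Bool) : Set ℝ := if b then Ioc 0 1 else Ico 0 1

theorem halfOpenUnit_subset (b : Bool) : halfOpenUnit b ⊆ Icc 0 1 := by
  cases b
  · exact Ico_subset_Icc_self
  · exact Ioc_subset_Icc_self

theorem one_sub_mem_halfOpenUnit {b : Bool} {c : ℝ} (hc : c ∈ halfOpenUnit b) :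
    1 - c ∈ halfOpenUnit (!b) := by
  cases b <;> simp [halfOpenUnit] at hc ⊢ <;> constructor <;> linarith

theorem mem_halfLine_iff {b : Bool} {c : ℝ} :
    c ∈ halfLine b ↔ c ∈ halfOpenUnit b ∨ c - 1 ∈ halfLine b := by
  cases b <;> simp only [halfLine, halfOpenUnit, if_true, if_false, Bool.false_eq_true, mem_Ici,
    mem_Ioi, mem_Ico, mem_Ioc] <;> constructor <;> intro h
  · by_cases h1 : c < 1
    · exact Or.inl ⟨h, h1⟩
    · exact Or.inr (by linarith)
  · rcases h with h | h <;> linarith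
  · by_cases h1 : c ≤ 1
    · exact Or.inl ⟨h, h1⟩
    · exact Or.inr (by linarith)
  · rcases h with h | h <;> linarith

theorem notMem_halfLine_of_mem_halfOpenUnit {b : Bool} {c : ℝ} (h : c ∈ halfOpenUnit b) :
    c - 1 ∉ halfLine b := by
  cases b <;> simp [halfLine, halfOpenUnit] at h ⊢ <;> linarith

theorem piece_finite (w : Fin k → Fin r → ℤ) {P : Fin k → Set ℝ} (hP : ∀ i, P i ⊆ Icc 0 1) :
    (piece w P).Finite := by
  refine (finite_norm_toReal_le (∑ i, ‖toReal (w i)‖)).subset ?_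
  rintro n ⟨c, hc, hn⟩
  rw [mem_ofPred_eq, hn]
  refine (norm_sum_le _ _).trans (Finset.sum_le_sum fun i _ => ?_)
  rw [norm_smul]
  have := hP i (hc i)
  refine mul_le_of_le_one_left (norm_nonneg _) ?_
  rw [Real.norm_of_nonneg this.1]
  exact this.2

section

variable {w : Fin k → Fin r → ℤ} (hw : LinearIndependent ℝ fun i => toReal (w i))
include hw

theorem coeff_unique {c d : Fin k → ℝ}
    (h : ∑ i, c i • toReal (w i) = ∑ i, d i • toReal (w i)) : c = d := by
  have h0 : ∑ i, (c i - d i) • toReal (w i) = 0 := by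
    simp only [sub_smul, Finset.sum_sub_distrib, h, sub_self]
  funext i
  exact sub_eq_zero.mp (Fintype.linearIndependent_iff.mp hw _ h0 i)

/-- A half line is the disjoint union of its first unit interval and its translate by `1`;
translating the `j`-th coordinate is translating by `w j`. This is the geometric series in disguise.
-/
theorem indicator_piece_step (P : Fin k → Set ℝ) (j : Fin k) (b : Bool) (hj : P j = halfLine b)
    (n : Fin r → ℤ) :
    (piece w P).indicator (1 : (Fin r → ℤ) → ℂ) n
      = (piece w (Function.update P j (halfOpenUnit b))).indicator 1 n
        + (piece w P).indicator 1 (n - w j) := by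
  classical
  have hshift : ∀ c : Fin k → ℝ, toReal n = ∑ i, c i • toReal (w i) →
      toReal (n - w j) = ∑ i, (c i - if i = j then 1 else 0) • toReal (w i) := by
    intro c hc
    simp [toReal_sub, hc, sub_smul, Finset.sum_sub_distrib]
  have hmem : ∀ c : Fin k → ℝ, toReal n = ∑ i, c i • toReal (w i) →
      ((n ∈ piece w P ↔ ∀ i, c i ∈ P i) ∧
      (n ∈ piece w (Function.update P j (halfOpenUnit b)) ↔
        (∀ i, c i ∈ Function.update P j (halfOpenUnit b) i)) ∧
      (n - w j ∈ piece w P ↔ ∀ i, (c i - if i = j then 1 else 0) ∈ P i)) := by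
    intro c hc
    refine ⟨⟨?_, fun h => ⟨c, h, hc⟩⟩, ⟨?_, fun h => ⟨c, h, hc⟩⟩,
      ⟨?_, fun h => ⟨_, h, hshift c hc⟩⟩⟩
    · rintro ⟨d, hd, hnd⟩
      rwa [coeff_unique hw (hc.symm.trans hnd)]
    · rintro ⟨d, hd, hnd⟩
      rwa [coeff_unique hw (hc.symm.trans hnd)]
    · rintro ⟨d, hd, hnd⟩
      have := coeff_unique hw ((hshift c hc).symm.trans hnd)
      intro i
      rw [congrFun this i]
      exact hd i
  by_cases hn : ∃ c : Fin k → ℝ, toReal n = ∑ i, c i • toReal (w i)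
  · obtain ⟨c, hc⟩ := hn
    obtain ⟨h1, h2, h3⟩ := hmem c hc
    have e1 : (∀ i, c i ∈ P i) ↔ (∀ i, i ≠ j → c i ∈ P i) ∧ c j ∈ halfLine b := by
      rw [← hj]
      exact ⟨fun h => ⟨fun i _ => h i, h j⟩, fun h i => by
        by_cases hij : i = j
        · exact hij ▸ h.2
        · exact h.1 i hij⟩
    have e2 : (∀ i, c i ∈ Function.update P j (halfOpenUnit b) i) ↔
        (∀ i, i ≠ j → c i ∈ P i) ∧ c j ∈ halfOpenUnit b := by
      refine ⟨fun h => ⟨fun i hi => ?_, ?_⟩, fun h i => ?_⟩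
      · simpa [hi] using h i
      · simpa using h j
      · by_cases hij : i = j
        · subst hij; simpa using h.2
        · simpa [hij] using h.1 i hij
    have e3 : (∀ i, (c i - if i = j then 1 else 0) ∈ P i) ↔
        (∀ i, i ≠ j → c i ∈ P i) ∧ c j - 1 ∈ halfLine b := by
      refine ⟨fun h => ⟨fun i hi => ?_, ?_⟩, fun h i => ?_⟩
      · simpa [hi] using h i
      · simpa [hj] using h j
      · by_cases hij : i = j
        · subst hij; simpa [hj] using h.2
        · simpa [hij] using h.1 i hij
    rw [e1] at h1
    rw [e2] at h2
    rw [e3] at h3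
    have hx := mem_halfLine_iff (b := b) (c := c j)
    have hy := notMem_halfLine_of_mem_halfOpenUnit (b := b) (c := c j)
    simp only [indicator_apply, h1, h2, h3, Pi.one_apply]
    by_cases ha : ∀ i, i ≠ j → c i ∈ P i
    · by_cases hb : c j ∈ halfOpenUnit b
      · simp [hb, hx, hy hb]
      · simp [hb, hx]
    · simp [ha]
  · have hn1 : ∀ Q : Fin k → Set ℝ, n ∉ piece w Q := fun Q ⟨c, _, hc⟩ => hn ⟨c, hc⟩
    have hn2 : n - w j ∉ piece w P := by
      rintro ⟨c, _, hc⟩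
      refine hn ⟨fun i => c i + if i = j then 1 else 0, ?_⟩
      rw [toReal_sub] at hc
      simp [add_smul, Finset.sum_add_distrib, ← hc]
    simp [hn1, hn2]

theorem hasSum_piece_step {ω : Fin r → ℂ} (P : Fin k → Set ℝ) (j : Fin k) (b : Bool)
    (hj : P j = halfLine b) {t S : ℂ}
    (hS : HasSum (fun n => (piece w P).indicator 1 n * Complex.exp (-(pairing ω n * t))) S) :
    HasSum (fun n => (piece w (Function.update P j (halfOpenUnit b))).indicator 1 n
        * Complex.exp (-(pairing ω n * t)))
      ((1 - Complex.exp (-(pairing ω (w j) * t))) * S) := by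
  have h1 : HasSum (fun n => (piece w P).indicator 1 (n - w j)
      * Complex.exp (-(pairing ω n * t))) (Complex.exp (-(pairing ω (w j) * t)) * S) := by
    have h2 := ((Equiv.subRight (w j)).hasSum_iff.mpr hS).mul_left
      (Complex.exp (-(pairing ω (w j) * t)))
    convert! h2 using 2 with n
    simp only [Function.comp_apply, Equiv.subRight_apply, pairing_sub]
    rw [mul_left_comm, ← Complex.exp_add]
    congr 2
    ring
  convert! hS.sub h1 using 1
  · funext n
    rw [indicator_piece_step hw P j b hj n]
    ring
  · ring

/-- The coordinates in `J` restricted to unit intervals, the others to half lines. -/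
def mixedBox (o : Fin k → Bool) (J : Finset (Fin k)) (i : Fin k) : Set ℝ :=
  if i ∈ J then halfOpenUnit (o i) else halfLine (o i)

theorem hasSum_piece_mixedBox {ω : Fin r → ℂ} (o : Fin k → Bool) (J : Finset (Fin k)) {t S : ℂ}
    (hS : HasSum (fun n => (piece w fun i => halfLine (o i)).indicator 1 n
      * Complex.exp (-(pairing ω n * t))) S) :
    HasSum (fun n => (piece w (mixedBox o J)).indicator 1 n * Complex.exp (-(pairing ω n * t)))
      ((∏ i ∈ J, (1 - Complex.exp (-(pairing ω (w i) * t)))) * S) := by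
  induction J using Finset.induction_on with
  | empty => simpa [mixedBox] using! hS
  | insert j J hj ih =>
    have h := hasSum_piece_step hw (mixedBox o J) j (o j) (by simp [mixedBox, hj]) ih
    have e : Function.update (mixedBox o J) j (halfOpenUnit (o j)) = mixedBox o (insert j J) := by
      funext i
      by_cases hi : i = j
      · subst hi; simp [mixedBox]
      · simp [mixedBox, hi]
    rw [e] at h
    rwa [Finset.prod_insert hj, mul_assoc]

end

/-- The lattice points of the half-open fundamental parallelepiped. -/
def fundamentalBox (w : Fin k → Fin r → ℤ) (o : Fin k → Bool) : Finset (Fin r → ℤ) :=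
  (piece_finite w fun i => halfOpenUnit_subset (o i)).toFinset

/-- The reflection `c ↦ 1 - c` exchanges `[0, 1)` and `(0, 1]`. This symmetry is the source of
reciprocity. -/
theorem sum_fundamentalBox_compl (w : Fin k → Fin r → ℤ) (o : Fin k → Bool)
    (f : (Fin r → ℤ) → ℂ) :
    ∑ n ∈ fundamentalBox w (fun i => !o i), f n
      = ∑ n ∈ fundamentalBox w o, f (∑ i, w i - n) := by
  have key : ∀ (o : Fin k → Bool) (n), n ∈ fundamentalBox w o →
      ∑ i, w i - n ∈ fundamentalBox w (fun i => !o i) := by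
    intro o n hn
    simp only [fundamentalBox, Set.Finite.mem_toFinset] at hn ⊢
    obtain ⟨c, hc, hn⟩ := hn
    refine ⟨fun i => 1 - c i, fun i => one_sub_mem_halfOpenUnit (hc i), ?_⟩
    rw [toReal_sub, toReal_sum, hn]
    simp [sub_smul, Finset.sum_sub_distrib]
  refine (Finset.sum_bij' (fun n _ => ∑ i, w i - n) (fun n _ => ∑ i, w i - n)
    (fun n hn => key o n hn) (fun n hn => ?_) (fun n _ => sub_sub_cancel _ _)
    (fun n _ => sub_sub_cancel _ _) (fun n _ => rfl)).symm
  simpa using key _ n hn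

/-- The meromorphic continuation of the exponential sum of a half-open simplicial cone. -/
def simplicialSum (ω : Fin r → ℂ) (w : Fin k → Fin r → ℤ) (o : Fin k → Bool) (t : ℂ) : ℂ :=
  (∑ n ∈ fundamentalBox w o, Complex.exp (-(pairing ω n * t)))
    * ∏ i, (1 - Complex.exp (-(pairing ω (w i) * t)))⁻¹

theorem one_sub_exp_ne_zero {x : ℂ} (hx : x.re ≠ 0) : 1 - Complex.exp x ≠ 0 := by
  intro h
  have := congrArg (‖·‖) (sub_eq_zero.mp h)
  simp only [norm_one, Complex.norm_exp] at this
  exact hx (Real.exp_eq_one_iff _ |>.mp this.symm)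

/-- Since `1 / (1 - e^{αt}) = -e^{-αt} / (1 - e^{-αt})`, replacing `t` by `-t` produces `(-1)^k
e^{-t ∑ α_i}`. The same exponential comes out of reflecting the box. -/
theorem simplicialSum_compl {ω : Fin r → ℂ} {w : Fin k → Fin r → ℤ} (o : Fin k → Bool)
    {t : ℂ} (hα : ∀ i, (pairing ω (w i) * t).re ≠ 0) :
    simplicialSum ω w (fun i => !o i) t = (-1) ^ k * simplicialSum ω w o (-t) := by
  have h1 : ∏ i, (1 - Complex.exp (-(pairing ω (w i) * -t)))⁻¹
      = (-1) ^ k * ((∏ i, Complex.exp (-(pairing ω (w i) * t)))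
        * ∏ i, (1 - Complex.exp (-(pairing ω (w i) * t)))⁻¹) := by
    rw [← Finset.prod_mul_distrib]
    have : ((-1 : ℂ)) ^ k = ∏ _i : Fin k, (-1 : ℂ) := by simp
    rw [this, ← Finset.prod_mul_distrib]
    refine Finset.prod_congr rfl fun i _ => ?_
    have h2 := one_sub_exp_ne_zero (hα i)
    have h3 := one_sub_exp_ne_zero (x := -(pairing ω (w i) * t))
      (by rw [Complex.neg_re]; exact neg_ne_zero.mpr (hα i))
    rw [mul_neg, neg_neg]
    rw [Complex.exp_neg] at h3 ⊢
    have h4 := Complex.exp_ne_zero (pairing ω (w i) * t)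
    field_simp
    have h5 : Complex.exp (pairing ω (w i) * t) - 1 ≠ 0 := by
      rw [← neg_sub]
      exact neg_ne_zero.mpr h2
    field_simp
    ring
  unfold simplicialSum
  rw [sum_fundamentalBox_compl, h1, ← Complex.exp_sum]
  have h6 : ((-1 : ℂ)) ^ k * (-1) ^ k = 1 := by rw [← mul_pow]; simp
  have h7 : ∑ n ∈ fundamentalBox w o, Complex.exp (-(pairing ω (∑ i, w i - n) * t))
      = Complex.exp (∑ i, -(pairing ω (w i) * t))
        * ∑ n ∈ fundamentalBox w o, Complex.exp (-(pairing ω n * -t)) := by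
    rw [Finset.mul_sum]
    refine Finset.sum_congr rfl fun n _ => ?_
    rw [← Complex.exp_add, pairing_sub, pairing_sum, Finset.sum_neg_distrib, ← Finset.sum_mul]
    congr 1
    ring
  rw [h7]
  linear_combination (-(Complex.exp (∑ i, -(pairing ω (w i) * t))
    * (∑ n ∈ fundamentalBox w o, Complex.exp (-(pairing ω n * -t)))
    * ∏ i, (1 - Complex.exp (-(pairing ω (w i) * t)))⁻¹)) * h6

/-- Dividing `1 - e^{-αt}` by `t` removes its simple zero and leaves the value `α ≠ 0` at the
origin. -/
theorem analyticAt_inv_dslope_exp {α : ℂ} (hα : α ≠ 0) :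
    AnalyticAt ℂ (fun t => (dslope (fun t => 1 - Complex.exp (-(α * t))) 0 t)⁻¹) 0 := by
  have h1 : AnalyticAt ℂ (fun t => 1 - Complex.exp (-(α * t))) 0 := by fun_prop
  obtain ⟨p, hp⟩ := h1
  refine AnalyticAt.fun_inv ⟨_, hp.has_fpower_series_dslope_fslope⟩ ?_
  rw [dslope_same]
  have : HasDerivAt (fun t => 1 - Complex.exp (-(α * t))) α 0 := by
    have h2 : HasDerivAt (fun t => -(α * t)) (-α) 0 := by
      simpa using! ((hasDerivAt_id (0 : ℂ)).const_mul α).neg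
    simpa using h2.cexp.const_sub 1
  rwa [this.deriv]

theorem exists_analyticAt_simplicialSum {ω : Fin r → ℂ} {w : Fin k → Fin r → ℤ} (hk : k ≤ r)
    (o : Fin k → Bool) (hα : ∀ i, pairing ω (w i) ≠ 0) :
    ∃ h : ℂ → ℂ, AnalyticAt ℂ h 0 ∧ ∀ t : ℂ, t ≠ 0 → h t = t ^ r * simplicialSum ω w o t := by
  refine ⟨fun t => t ^ (r - k) * (∑ n ∈ fundamentalBox w o, Complex.exp (-(pairing ω n * t)))
    * ∏ i, (dslope (fun t => 1 - Complex.exp (-(pairing ω (w i) * t))) 0 t)⁻¹, ?_, ?_⟩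
  · refine AnalyticAt.fun_mul ?_ ?_
    · fun_prop
    · exact Finset.analyticAt_fun_prod _ fun i _ => analyticAt_inv_dslope_exp (hα i)
  · intro t ht
    have h1 : ∀ i, (dslope (fun t => 1 - Complex.exp (-(pairing ω (w i) * t))) 0 t)⁻¹
        = t * (1 - Complex.exp (-(pairing ω (w i) * t)))⁻¹ := by
      intro i
      rw [dslope_of_ne _ ht, slope_def_field]
      simp [div_eq_mul_inv, mul_comm]
    simp only [h1, Finset.prod_mul_distrib, Finset.prod_const, Finset.card_univ, Fintype.card_fin]
    obtain ⟨m, rfl⟩ := Nat.exists_eq_add_of_le hk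
    rw [Nat.add_sub_cancel_left, pow_add, simplicialSum]
    ring

theorem summable_indicator_piece {ω : Fin r → ℂ} {δ : ℝ} (hδ : 0 < δ) {A : Set (Fin r → ℤ)}
    (hA : ∀ n ∈ A, δ * ‖toReal n‖ ≤ (pairing ω n).re) {t : ℝ} (ht : 0 < t) :
    Summable fun n => A.indicator 1 n * Complex.exp (-(pairing ω n * t)) := by
  refine Summable.of_norm_bounded (summable_exp_neg_norm (mul_pos hδ ht)) fun n => ?_
  by_cases hn : n ∈ A
  · simp only [hn, indicator_of_mem, Pi.one_apply, one_mul, Complex.norm_exp, Complex.neg_re,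
      Complex.re_mul_ofReal]
    have := hA n hn
    refine Real.exp_le_exp.mpr (neg_le_neg ?_)
    nlinarith
  · simp [hn, (Real.exp_pos _).le]

/-- The series converges absolutely. Multiplying it by all factors `1 - e^{-α_i t}` cuts it down to
the finite box sum, and the factors are nonzero. -/
theorem hasSum_simplicialSum {ω : Fin r → ℂ} {w : Fin k → Fin r → ℤ}
    (hw : LinearIndependent ℝ fun i => toReal (w i)) (o : Fin k → Bool)
    (hα : ∀ i, 0 < (pairing ω (w i)).re) {δ : ℝ} (hδ : 0 < δ)
    (hb : ∀ n ∈ piece w (fun _ => Ici 0), δ * ‖toReal n‖ ≤ (pairing ω n).re) {t : ℝ}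
    (ht : 0 < t) :
    HasSum (fun n => (piece w fun i => halfLine (o i)).indicator 1 n
      * Complex.exp (-(pairing ω n * t))) (simplicialSum ω w o t) := by
  have hsub : ∀ n ∈ piece w (fun i => halfLine (o i)), δ * ‖toReal n‖ ≤ (pairing ω n).re := by
    rintro n ⟨c, hc, hn⟩
    refine hb n ⟨c, fun i => ?_, hn⟩
    have := hc i
    cases h : o i <;> simp [halfLine, h] at this ⊢ <;> linarith
  have h1 := (summable_indicator_piece hδ hsub ht).hasSum
  set S := ∑' n, (piece w fun i => halfLine (o i)).indicator 1 n
      * Complex.exp (-(pairing ω n * t)) with hS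
  have h2 := hasSum_piece_mixedBox hw o Finset.univ h1
  have h3 : HasSum (fun n => (piece w (mixedBox o Finset.univ)).indicator 1 n
      * Complex.exp (-(pairing ω n * t)))
      (∑ n ∈ fundamentalBox w o, Complex.exp (-(pairing ω n * t))) := by
    have hm : ∀ n, n ∈ piece w (mixedBox o Finset.univ) ↔ n ∈ fundamentalBox w o := by
      intro n
      have : mixedBox o Finset.univ = fun i => halfOpenUnit (o i) := by
        funext i; simp [mixedBox]
      simp [fundamentalBox, this]
    have h4 := hasSum_sum_of_ne_finset_zero (L := SummationFilter.unconditional _) (s := fundamentalBox w o)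
      (f := fun n => (piece w (mixedBox o Finset.univ)).indicator 1 n
        * Complex.exp (-(pairing ω n * t)))
      (fun n hn => by simp [(hm n).not.mpr hn])
    convert! h4 using 1
    refine Finset.sum_congr rfl fun n hn => ?_
    simp [(hm n).mpr hn]
  have h5 := h2.unique h3
  have h6 : simplicialSum ω w o t = S := by
    rw [simplicialSum, ← h5, mul_right_comm, ← Finset.prod_mul_distrib, Finset.prod_eq_one,
      one_mul]
    intro i _
    refine mul_inv_cancel₀ (one_sub_exp_ne_zero ?_)
    rw [Complex.neg_re, Complex.re_mul_ofReal]
    exact (neg_lt_zero.mpr (mul_pos (hα i) ht)).ne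
  rw [h6]
  exact h1

/-- A `k`-dimensional cone has reciprocity sign `(-1)^k`; the scalar `(-1)^(r - k)` brings it to the
common sign `(-1)^r`. -/
theorem reciprocal_piece {ω : Fin r → ℂ} {w : Fin k → Fin r → ℤ} (hk : k ≤ r)
    (hw : LinearIndependent ℝ fun i => toReal (w i)) (o : Fin k → Bool)
    (hα : ∀ i, 0 < (pairing ω (w i)).re) {δ : ℝ} (hδ : 0 < δ)
    (hb : ∀ n ∈ piece w (fun _ => Ici 0), δ * ‖toReal n‖ ≤ (pairing ω n).re) :
    Reciprocal ω ((piece w fun i => halfLine (o i)).indicator 1)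
      ((-1 : ℂ) ^ (r - k) • (piece w fun i => halfLine (!o i)).indicator 1) := by
  obtain ⟨h, h1, h2⟩ := exists_analyticAt_simplicialSum (ω := ω) (w := w) hk o (fun i hi => by
    simpa only [hi, Complex.zero_re, lt_irrefl] using hα i)
  refine ⟨h, h1, ?_⟩
  filter_upwards [self_mem_nhdsWithin] with t ht
  have ht0 : (t : ℂ) ≠ 0 := by exact_mod_cast (ne_of_gt ht : t ≠ 0)
  refine ⟨?_, ?_⟩
  · rw [h2 t ht0, mul_div_cancel_left₀ _ (pow_ne_zero _ ht0)]
    exact hasSum_simplicialSum hw o hα hδ hb ht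
  · have h3 := (hasSum_simplicialSum hw (fun i => !o i) hα hδ hb ht).mul_left
      ((-1 : ℂ) ^ (r - k))
    rw [simplicialSum_compl o (fun i => by
      rw [Complex.re_mul_ofReal]
      exact (mul_pos (hα i) ht).ne')] at h3
    convert! h3 using 1
    · funext n
      simp only [Pi.smul_apply, smul_eq_mul, mul_assoc]
    · rw [h2 _ (neg_ne_zero.mpr ht0), neg_pow, ← mul_assoc, ← pow_add, Nat.sub_add_cancel hk]
      field_simp

end GenSine

/-! ### Cones and their interiors; the plane case -/

namespace GenSine

open Filter Topology Set

variable {r : ℕ}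

theorem toReal_dotProduct (n m : Fin r → ℤ) : toReal n ⬝ᵥ toReal m = ((n ⬝ᵥ m : ℤ) : ℝ) := by
  simp [dotProduct, toReal]

theorem IsPrimitive.ne_zero {v : Fin r → ℤ} (hv : IsPrimitive v) : v ≠ 0 := by
  rintro rfl
  have := hv 0 (fun j => dvd_refl _)
  simp at this

theorem toReal_ne_zero {v : Fin r → ℤ} (hv : v ≠ 0) : toReal v ≠ 0 := by
  intro h
  exact hv (toReal_injective (h.trans (by funext j; simp [toReal])))

theorem dotProduct_self_pos {x : Fin r → ℝ} (hx : x ≠ 0) : 0 < x ⬝ᵥ x :=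
  lt_of_le_of_ne (Finset.sum_nonneg fun i _ => mul_self_nonneg (x i)) fun h => hx (dotProduct_self_eq_zero.mp h.symm)

namespace RatCone

variable (C : RatCone r)

theorem mem_carrier {x : Fin r → ℝ} : x ∈ C.carrier ↔ ∀ v ∈ C.normals, 0 ≤ x ⬝ᵥ toReal v :=
  Iff.rfl

theorem mem_interior_carrier {x : Fin r → ℝ} :
    x ∈ interior C.carrier ↔ ∀ v ∈ C.normals, 0 < x ⬝ᵥ toReal v := by
  constructor
  · intro hx v hv
    have hpos := dotProduct_self_pos (toReal_ne_zero (C.primitive v hv).ne_zero)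
    -- A small step from an interior point against `v` stays in the cone, so the pairing with `v`
    -- has room to decrease.
    have hcont : Continuous fun t : ℝ => x - t • toReal v := by fun_prop
    have hev : ∀ᶠ t : ℝ in 𝓝 0, x - t • toReal v ∈ C.carrier :=
      hcont.continuousAt.eventually (by simpa using mem_interior_iff_mem_nhds.mp hx)
    obtain ⟨t, ht, ht0⟩ := ((hev.filter_mono nhdsWithin_le_nhds).and
      (self_mem_nhdsWithin (a := (0 : ℝ)) (s := Ioi 0))).exists
    have := ht v hv
    rw [sub_dotProduct, smul_dotProduct, smul_eq_mul] at this
    have := mul_pos (show (0 : ℝ) < t from ht0) hpos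
    linarith
  · intro hx
    have hopen : IsOpen (⋂ v ∈ C.normals, {x : Fin r → ℝ | 0 < x ⬝ᵥ toReal v}) :=
      isOpen_biInter_finset fun v _ => isOpen_lt continuous_const (by
        simp only [dotProduct]; fun_prop)
    refine interior_maximal (fun y hy v hv => ?_) hopen (by simpa using hx)
    simp only [mem_iInter] at hy
    exact (show 0 < y ⬝ᵥ toReal v from hy v hv).le

variable {C}

theorem smul_mem_carrier {x : Fin r → ℝ} (hx : x ∈ C.carrier) {c : ℝ} (hc : 0 ≤ c) :
    c • x ∈ C.carrier := fun v hv => by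
  rw [smul_dotProduct]; exact mul_nonneg hc (hx v hv)

theorem sum_smul_mem_carrier {ι : Type*} (s : Finset ι) {c : ι → ℝ} {x : ι → Fin r → ℝ}
    (hc : ∀ i ∈ s, 0 ≤ c i) (hx : ∀ i ∈ s, x i ∈ C.carrier) :
    ∑ i ∈ s, c i • x i ∈ C.carrier := fun v hv => by
  rw [sum_dotProduct]
  exact Finset.sum_nonneg fun i hi => smul_mem_carrier (hx i hi) (hc i hi) v hv

theorem normals_nonempty (hr : r ≠ 0) (C : RatCone r) : C.normals.Nonempty := by
  by_contra h
  rw [Finset.not_nonempty_iff_eq_empty] at h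
  have : ∀ x : Fin r → ℝ, x ∈ polyCone (C.normals : Set (Fin r → ℤ)) := fun x v hv => by
    simp [h] at hv
  have h1 := congrFun (C.strictlyConvex 1 (this _) (this _)) ⟨0, Nat.pos_of_ne_zero hr⟩
  simp at h1

/-- Half-open pieces whose generators lie in the cone are reciprocal to the opposite ones. -/
theorem reciprocal_piece_of_mem {k : ℕ} {ω : Fin r → ℂ} {δ : ℝ} (hδ : 0 < δ)
    (hC : ∀ u ∈ C.carrier, δ * ‖u‖ ≤ (fun j => (ω j).re) ⬝ᵥ u) (hk : k ≤ r)
    {w : Fin k → Fin r → ℤ} (hw : LinearIndependent ℝ fun i => toReal (w i))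
    (hwC : ∀ i, toReal (w i) ∈ C.carrier) (o : Fin k → Bool) :
    Reciprocal ω ((piece w fun i => halfLine (o i)).indicator 1)
      ((-1 : ℂ) ^ (r - k) • (piece w fun i => halfLine (!o i)).indicator 1) := by
  refine reciprocal_piece hk hw o (fun i => ?_) hδ ?_
  · rw [pairing_re]
    exact (mul_pos hδ (norm_pos_iff.mpr (hw.ne_zero i))).trans_le (hC _ (hwC i))
  · rintro n ⟨c, hc, hn⟩
    rw [pairing_re]
    refine hC _ ?_
    rw [hn]
    exact sum_smul_mem_carrier _ (fun i _ => hc i) fun i _ => hwC i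

end RatCone

/-- Among linear forms on a plane that are positive at a point `e`, two bound the cone on which
all are nonnegative. -/
theorem exists_extreme_pair {ι : Type*} (s : Finset ι) (e d : ι → ℝ) (he : ∀ i ∈ s, 0 < e i)
    (hp : ∃ i ∈ s, 0 < d i) (hn : ∃ i ∈ s, d i < 0) :
    ∃ a ∈ s, ∃ b ∈ s, 0 < d a ∧ d b < 0 ∧
      (∀ σ τ : ℝ, 0 ≤ σ * e a + τ * d a → 0 ≤ σ * e b + τ * d b →
        ∀ i ∈ s, 0 ≤ σ * e i + τ * d i) ∧
      (∀ σ τ : ℝ, 0 < σ * e a + τ * d a → 0 < σ * e b + τ * d b →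
        ∀ i ∈ s, 0 < σ * e i + τ * d i) := by
  -- For `σ ≥ 0` the form is `d i` times `σ (e i / d i) + τ` when `d i > 0`, and `-d i` times `σ (e
  -- i / -d i) - τ` when `d i < 0`. In each class the smallest ratio gives the strongest condition.
  obtain ⟨a, ha, hamin⟩ := Finset.exists_min_image (s.filter fun i => 0 < d i)
    (fun i => e i / d i) (by obtain ⟨i, hi, h⟩ := hp; exact ⟨i, by simp [hi, h]⟩)
  obtain ⟨b, hb, hbmin⟩ := Finset.exists_min_image (s.filter fun i => d i < 0)
    (fun i => e i / -d i) (by obtain ⟨i, hi, h⟩ := hn; exact ⟨i, by simp [hi, h]⟩)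
  rw [Finset.mem_filter] at ha hb
  have hA := div_pos (he a ha.1) ha.2
  have hB := div_pos (he b hb.1) (neg_pos.mpr hb.2)
  have pos_form : ∀ i, 0 < d i → ∀ σ τ : ℝ, σ * e i + τ * d i = d i * (σ * (e i / d i) + τ) := by
    intro i hi σ τ
    field_simp
  have neg_form : ∀ i, d i < 0 → ∀ σ τ : ℝ,
      σ * e i + τ * d i = -d i * (σ * (e i / -d i) - τ) := by
    intro i hi σ τ
    have := hi.ne
    field_simp
    ring
  refine ⟨a, ha.1, b, hb.1, ha.2, hb.2, fun σ τ h1 h2 i hi => ?_, fun σ τ h1 h2 i hi => ?_⟩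
  · rw [pos_form a ha.2, mul_nonneg_iff_of_pos_left ha.2] at h1
    rw [neg_form b hb.2, mul_nonneg_iff_of_pos_left (neg_pos.mpr hb.2)] at h2
    -- Adding the two conditions eliminates `τ` and leaves `σ` times a positive number.
    have hσ : 0 ≤ σ := by
      by_contra h
      push Not at h
      nlinarith
    rcases lt_trichotomy (d i) 0 with h | h | h
    · rw [neg_form i h]
      have := mul_le_mul_of_nonneg_left (hbmin i (by simp [hi, h])) hσ
      exact mul_nonneg (neg_pos.mpr h).le (by linarith)
    · rw [h, mul_zero, add_zero]
      exact mul_nonneg hσ (he i hi).le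
    · rw [pos_form i h]
      have := mul_le_mul_of_nonneg_left (hamin i (by simp [hi, h])) hσ
      exact mul_nonneg h.le (by linarith)
  · rw [pos_form a ha.2, mul_pos_iff_of_pos_left ha.2] at h1
    rw [neg_form b hb.2, mul_pos_iff_of_pos_left (neg_pos.mpr hb.2)] at h2
    have hσ : 0 < σ := by
      by_contra h
      push Not at h
      nlinarith
    rcases lt_trichotomy (d i) 0 with h | h | h
    · rw [neg_form i h]
      have := mul_le_mul_of_nonneg_left (hbmin i (by simp [hi, h])) hσ.le
      exact mul_pos (neg_pos.mpr h) (by linarith)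
    · rw [h, mul_zero, add_zero]
      exact mul_pos hσ (he i hi)
    · rw [pos_form i h]
      have := mul_le_mul_of_nonneg_left (hamin i (by simp [hi, h])) hσ.le
      exact mul_pos h (by linarith)

theorem smul_mem_halfLine_iff {b : Bool} {c x : ℝ} (hc : 0 < c) :
    x / c ∈ halfLine b ↔ x ∈ halfLine b := by
  cases b <;> simp [halfLine, div_nonneg_iff, hc, hc.le, hc.not_ge]

theorem mul_mem_halfLine_iff {b : Bool} {c x : ℝ} (hc : 0 < c) :
    x * c ∈ halfLine b ↔ x ∈ halfLine b := by
  cases b <;> simp [halfLine, hc]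

/-- The lattice points of the cone (if `b = false`) or of its interior. -/
def RatCone.points (C : RatCone r) (b : Bool) : Set (Fin r → ℤ) :=
  {n | ∀ v ∈ C.normals, toReal n ⬝ᵥ toReal v ∈ halfLine b}

theorem RatCone.points_false (C : RatCone r) : C.points false = latticePoints C.carrier := by
  ext n
  simp [points, halfLine, latticePoints, mem_carrier]

theorem RatCone.points_true (C : RatCone r) :
    C.points true = latticePoints (interior C.carrier) := by
  ext n
  simp [points, halfLine, latticePoints, mem_interior_carrier]

theorem eq_div_smul_add_div_smul {c p q : ℝ} {x u v : Fin r → ℝ} (hc : c ≠ 0)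
    (h : c • x = p • u + q • v) : x = (p / c) • u + (q / c) • v := by
  rw [← inv_smul_smul₀ hc x, h, smul_add, smul_smul, smul_smul, div_eq_inv_mul, div_eq_inv_mul]

section Plane

/-- The rotation by a right angle. -/
def perp {R : Type*} [Neg R] (x : Fin 2 → R) : Fin 2 → R := ![-x 1, x 0]

theorem toReal_perp (n : Fin 2 → ℤ) : toReal (perp n) = perp (toReal n) := by
  funext j
  fin_cases j <;> simp [toReal, perp]

theorem toReal_smul (c : ℤ) (n : Fin r → ℤ) : toReal (c • n) = (c : ℝ) • toReal n := by
  funext j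
  simp [toReal]

/-- Cramer's rule: the coordinates of `x` in the basis `perp a`, `perp b` are read off from its
pairings with `b` and `a`. -/
theorem det_smul_eq (a b x : Fin 2 → ℝ) :
    (b ⬝ᵥ perp a) • x = (x ⬝ᵥ b) • perp a - (x ⬝ᵥ a) • perp b := by
  funext j
  fin_cases j <;> simp [perp, dotProduct, Fin.sum_univ_two] <;> ring

theorem dotProduct_perp_self (a : Fin 2 → ℝ) : perp a ⬝ᵥ a = 0 := by
  simp [perp, dotProduct, Fin.sum_univ_two]; ring

theorem dotProduct_perp (a b : Fin 2 → ℝ) : perp b ⬝ᵥ a = -(b ⬝ᵥ perp a) := by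
  simp [perp, dotProduct, Fin.sum_univ_two]

theorem perp_perp (a : Fin 2 → ℝ) : perp (perp a) = -a := by
  funext j
  fin_cases j <;> simp [perp]

theorem det_mul_det (a b q d : Fin 2 → ℝ) :
    (b ⬝ᵥ perp a) * (d ⬝ᵥ perp q) = (q ⬝ᵥ a) * (d ⬝ᵥ b) - (d ⬝ᵥ a) * (q ⬝ᵥ b) := by
  simp [perp, dotProduct, Fin.sum_univ_two]; ring

/-- In the basis of an interior point `q` and a vector `d` orthogonal to `η`, all normals are
positive at `q`. Neither `d` nor `-d` is in the cone, so the normals take both signs at `d` and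
`exists_extreme_pair` applies. -/
theorem RatCone.exists_two_normals (C : RatCone 2) {η : Fin 2 → ℝ} {δ : ℝ} (hδ : 0 < δ)
    (hC : ∀ u ∈ C.carrier, δ * ‖u‖ ≤ η ⬝ᵥ u) :
    ∃ a ∈ C.normals, ∃ b ∈ C.normals, b ⬝ᵥ perp a ≠ 0 ∧ ∀ β : Bool, ∀ x : Fin 2 → ℝ,
      x ⬝ᵥ toReal a ∈ halfLine β → x ⬝ᵥ toReal b ∈ halfLine β →
        ∀ v ∈ C.normals, x ⬝ᵥ toReal v ∈ halfLine β := by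
  obtain ⟨q, hq⟩ := C.fullDimensional
  have hq' := C.mem_interior_carrier.mp hq
  have hqC : q ∈ C.carrier := interior_subset hq
  obtain ⟨v₀, hv₀⟩ := RatCone.normals_nonempty (by norm_num) C
  have hq0 : q ≠ 0 := by
    rintro rfl
    simpa using hq' v₀ hv₀
  have hηq : 0 < η ⬝ᵥ q := (mul_pos hδ (norm_pos_iff.mpr hq0)).trans_le (hC q hqC)
  set d := perp η with hd
  have hηd : η ⬝ᵥ d = 0 := by rw [dotProduct_comm]; exact dotProduct_perp_self η
  have hd0 : d ≠ 0 := by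
    intro h
    have h0 := congrFun h 0
    have h1 := congrFun h 1
    simp [hd, perp] at h0 h1
    have : η = 0 := by funext j; fin_cases j <;> simp [h0, h1]
    simp [this] at hηq
  have hnot : ∀ y : Fin 2 → ℝ, y ≠ 0 → η ⬝ᵥ y = 0 → ∃ v ∈ C.normals, y ⬝ᵥ toReal v < 0 := by
    intro y hy hηy
    by_contra h
    push Not at h
    have h1 := hC y h
    rw [hηy] at h1
    exact absurd h1 (not_le.mpr (mul_pos hδ (norm_pos_iff.mpr hy)))
  obtain ⟨a, ha, b, hb, hda, hdb, h1, h2⟩ := exists_extreme_pair C.normals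
    (fun v => q ⬝ᵥ toReal v) (fun v => d ⬝ᵥ toReal v) hq'
    (by
      obtain ⟨v, hv, h⟩ := hnot (-d) (neg_ne_zero.mpr hd0) (by simp [hηd])
      exact ⟨v, hv, by rwa [neg_dotProduct, neg_lt_zero] at h⟩)
    (hnot d hd0 hηd)
  have hdecomp : ∀ x : Fin 2 → ℝ, ∃ σ τ : ℝ, x = σ • q + τ • d := by
    intro x
    have h3 := det_smul_eq η (perp q) x
    have h4 : perp q ⬝ᵥ perp η = η ⬝ᵥ q := by
      rw [dotProduct_perp, perp_perp, dotProduct_neg, neg_neg, dotProduct_comm]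
    rw [h4, perp_perp] at h3
    refine ⟨_, _, eq_div_smul_add_div_smul hηq.ne' (p := x ⬝ᵥ η) (q := x ⬝ᵥ perp q) ?_⟩
    rw [h3]
    module
  refine ⟨a, ha, b, hb, ?_, fun β x hxa hxb v hv => ?_⟩
  · intro h
    -- The right side of the identity is strictly negative by the signs at `q` and `d`, so the
    -- determinant cannot vanish.
    have h3 := det_mul_det (toReal a) (toReal b) q d
    rw [← toReal_perp, toReal_dotProduct, h] at h3
    have h4 := mul_pos (hq' b hb) hda
    have h5 := mul_pos (hq' a ha) (neg_pos.mpr hdb)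
    simp only [Int.cast_zero, zero_mul] at h3
    nlinarith
  · obtain ⟨σ, τ, rfl⟩ := hdecomp x
    simp only [add_dotProduct, smul_dotProduct, smul_eq_mul] at hxa hxb ⊢
    cases β
    · exact h1 σ τ hxa hxb v hv
    · exact h2 σ τ hxa hxb v hv

theorem RatCone.reciprocal_two (C : RatCone 2) {ω : Fin 2 → ℂ} {δ : ℝ} (hδ : 0 < δ)
    (hC : ∀ u ∈ C.carrier, δ * ‖u‖ ≤ (fun j => (ω j).re) ⬝ᵥ u) :
    Reciprocal ω ((C.points false).indicator 1) ((C.points true).indicator 1) := by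
  obtain ⟨a, ha, b, hb, hD, hab⟩ := C.exists_two_normals hδ hC
  set D : ℤ := b ⬝ᵥ perp a with hDdef
  have hDR : (toReal b ⬝ᵥ perp (toReal a)) = (D : ℝ) := by
    rw [← toReal_perp, toReal_dotProduct]
  have hD2 : (0 : ℝ) < (D : ℝ) ^ 2 := by positivity
  -- Scaling by the determinant `D` keeps the generators integral and makes the nonzero pairings `D
  -- ^ 2`, positive for either orientation of `a`, `b`.
  let w : Fin 2 → Fin 2 → ℤ := ![D • perp a, -D • perp b]
  have hw0 : toReal (w 0) = (D : ℝ) • perp (toReal a) := by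
    rw [← toReal_perp, ← toReal_smul]; rfl
  have hw1 : toReal (w 1) = (-D : ℝ) • perp (toReal b) := by
    rw [← toReal_perp, ← Int.cast_neg, ← toReal_smul]; rfl
  have hwa : ∀ i, toReal (w i) ⬝ᵥ toReal a = ![0, (D : ℝ) ^ 2] i := by
    rw [Fin.forall_fin_two, hw0, hw1]
    simp only [smul_dotProduct, dotProduct_perp_self, dotProduct_perp, hDR, smul_eq_mul,
      Matrix.cons_val_zero, Matrix.cons_val_one]
    exact ⟨by ring, by ring⟩
  have hwb : ∀ i, toReal (w i) ⬝ᵥ toReal b = ![(D : ℝ) ^ 2, 0] i := by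
    rw [Fin.forall_fin_two, hw0, hw1, smul_dotProduct, smul_dotProduct, dotProduct_comm, hDR,
      dotProduct_perp_self]
    simp only [smul_eq_mul, Matrix.cons_val_zero, Matrix.cons_val_one]
    exact ⟨by ring, by ring⟩
  have hsum : ∀ x : Fin 2 → ℝ, x = ∑ i, (![x ⬝ᵥ toReal b / (D : ℝ) ^ 2,
      x ⬝ᵥ toReal a / (D : ℝ) ^ 2] i) • toReal (w i) := by
    intro x
    have h := det_smul_eq (toReal a) (toReal b) x
    rw [hDR] at h
    rw [Fin.sum_univ_two, hw0, hw1]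
    refine eq_div_smul_add_div_smul hD2.ne' ?_
    rw [pow_two, mul_smul, h]
    module
  have hdot : ∀ c : Fin 2 → ℝ, (∑ i, c i • toReal (w i)) ⬝ᵥ toReal b = c 0 * (D : ℝ) ^ 2 ∧
      (∑ i, c i • toReal (w i)) ⬝ᵥ toReal a = c 1 * (D : ℝ) ^ 2 := by
    intro c
    simp [hwa, hwb]
  have hmem : ∀ β, piece w (fun _ => halfLine β) = C.points β := by
    intro β
    ext n
    constructor
    · rintro ⟨c, hc, hn⟩
      refine hab β (toReal n) ?_ ?_
      · rw [hn, (hdot c).2, mul_mem_halfLine_iff hD2]; exact hc 1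
      · rw [hn, (hdot c).1, mul_mem_halfLine_iff hD2]; exact hc 0
    · intro hn
      refine ⟨_, fun i => ?_, hsum (toReal n)⟩
      fin_cases i
      · exact (smul_mem_halfLine_iff hD2).mpr (hn b hb)
      · exact (smul_mem_halfLine_iff hD2).mpr (hn a ha)
  have hlin : LinearIndependent ℝ fun i => toReal (w i) := by
    rw [Fintype.linearIndependent_iff]
    intro c hc
    have h := hdot c
    rw [hc, zero_dotProduct, zero_dotProduct] at h
    intro i
    fin_cases i
    · simpa [hD2.ne'] using h.1.symm
    · simpa [hD2.ne'] using h.2.symm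
  have hwC : ∀ i, toReal (w i) ∈ C.carrier := by
    intro i v hv
    have := hab false (toReal (w i))
      (by rw [hwa]; fin_cases i <;> simp [halfLine, sq_nonneg])
      (by rw [hwb]; fin_cases i <;> simp [halfLine, sq_nonneg]) v hv
    exact this
  have h := RatCone.reciprocal_piece_of_mem hδ hC le_rfl hlin hwC (fun _ => false)
  simpa [hmem] using h

end Plane

end GenSine

/-! ### Facets of a three-dimensional cone -/

namespace GenSine

open Filter Topology Set

section Space

theorem toReal_cross (p q : Fin 3 → ℤ) :
    toReal (crossProduct p q) = crossProduct (toReal p) (toReal q) := by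
  funext j
  fin_cases j <;> simp [toReal, cross_apply]

/-- Cramer's rule in the plane orthogonal to `v`. -/
theorem triple_smul_eq {a b v y : Fin 3 → ℝ} (hv : y ⬝ᵥ v = 0) :
    (b ⬝ᵥ crossProduct v a) • y
      = (y ⬝ᵥ b) • crossProduct v a + (y ⬝ᵥ a) • crossProduct b v := by
  simp only [dotProduct, Fin.sum_univ_three] at hv
  funext j
  fin_cases j
  · simp [cross_apply, dotProduct, Fin.sum_univ_three]
    linear_combination (a 1 * b 2 - a 2 * b 1) * hv
  · simp [cross_apply, dotProduct, Fin.sum_univ_three]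
    linear_combination (a 2 * b 0 - a 0 * b 2) * hv
  · simp [cross_apply, dotProduct, Fin.sum_univ_three]
    linear_combination (a 0 * b 1 - a 1 * b 0) * hv

/-- The analogue of `det_mul_det` in the plane orthogonal to `v`; it shows that `a` and `b` are
independent on that plane. -/
theorem triple_mul_triple {a b v e d : Fin 3 → ℝ} (he : e ⬝ᵥ v = 0) (hd : d ⬝ᵥ v = 0) :
    (b ⬝ᵥ crossProduct v a) * (e ⬝ᵥ crossProduct v d)
      = (v ⬝ᵥ v) * ((e ⬝ᵥ b) * (d ⬝ᵥ a) - (d ⬝ᵥ b) * (e ⬝ᵥ a)) := by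
  have h := congrArg (fun x => x ⬝ᵥ crossProduct v d) (triple_smul_eq (a := a) (b := b) he)
  simp only [smul_dotProduct, add_dotProduct, smul_eq_mul] at h
  rw [h]
  rw [cross_dot_cross, cross_dot_cross, dotProduct_comm v d, hd, dotProduct_comm a d,
    dotProduct_comm b d]
  ring

theorem dotProduct_smul_eq_of_cross_eq_zero {d y : Fin 3 → ℝ} (h : crossProduct d y = 0) :
    (d ⬝ᵥ d) • y = (y ⬝ᵥ d) • d := by
  have h1 := cross_cross_eq_smul_sub_smul' d d y
  rw [h, map_zero] at h1
  rw [dotProduct_comm y d]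
  exact (sub_eq_zero.mp h1.symm).symm

/-- Generators `left`, `right` of a facet of a three-dimensional cone, with normals `a`, `b` that
serve as coordinates on it. -/
structure FacetRays (C : RatCone 3) (v : Fin 3 → ℤ) where
  a : Fin 3 → ℤ
  b : Fin 3 → ℤ
  left : Fin 3 → ℤ
  right : Fin 3 → ℤ
  scale : ℝ
  a_mem : a ∈ C.normals
  b_mem : b ∈ C.normals
  a_ne : a ≠ v
  b_ne : b ≠ v
  scale_pos : 0 < scale
  left_v : toReal left ⬝ᵥ toReal v = 0
  right_v : toReal right ⬝ᵥ toReal v = 0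
  left_a : toReal left ⬝ᵥ toReal a = 0
  right_a : toReal right ⬝ᵥ toReal a = scale
  left_b : toReal left ⬝ᵥ toReal b = scale
  right_b : toReal right ⬝ᵥ toReal b = 0
  eq_add : ∀ y : Fin 3 → ℝ, y ⬝ᵥ toReal v = 0 →
    y = (y ⬝ᵥ toReal b / scale) • toReal left + (y ⬝ᵥ toReal a / scale) • toReal right
  mem_halfLine : ∀ β : Bool, ∀ y : Fin 3 → ℝ, y ⬝ᵥ toReal v = 0 →
    y ⬝ᵥ toReal a ∈ halfLine β → y ⬝ᵥ toReal b ∈ halfLine β →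
      ∀ i ∈ C.normals, i ≠ v → y ⬝ᵥ toReal i ∈ halfLine β

theorem exists_orthogonal_ne_zero (v : Fin 3 → ℝ) :
    ∃ p : Fin 3 → ℝ, p ≠ 0 ∧ p ⬝ᵥ v = 0 := by
  by_cases h : v = 0
  · exact ⟨1, one_ne_zero, by simp [h]⟩
  · obtain ⟨j, hj⟩ := Function.ne_iff.mp h
    have hj' : v j ≠ 0 := hj
    fin_cases j
    · refine ⟨![-v 1, v 0, 0], fun h => hj' (by simpa using congrFun h 1), ?_⟩
      simp [dotProduct, Fin.sum_univ_three]; ring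
    · refine ⟨![-v 1, v 0, 0], fun h => hj' (by simpa using congrFun h 0), ?_⟩
      simp [dotProduct, Fin.sum_univ_three]; ring
    · refine ⟨![0, -v 2, v 1], fun h => hj' (by simpa using congrFun h 1), ?_⟩
      simp [dotProduct, Fin.sum_univ_three]; ring

/-- Minimality gives a point violating only the inequality of `v`. Sliding it along `ξ` onto the
plane of `v` raises every pairing by the same positive amount. -/
theorem RatCone.exists_facet_point {r : ℕ} (C : RatCone r) {ξ : Fin r → ℤ}
    (hξ : ∀ v ∈ C.normals, ξ ⬝ᵥ v = 1) {v : Fin r → ℤ} (hv : v ∈ C.normals) :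
    ∃ e : Fin r → ℝ, e ⬝ᵥ toReal v = 0 ∧ ∀ i ∈ C.normals, i ≠ v → 0 < e ⬝ᵥ toReal i := by
  have hne := C.minimal v hv
  have hsub : polyCone (C.normals : Set (Fin r → ℤ))
      ⊆ polyCone ((C.normals : Set (Fin r → ℤ)) \ {v}) := fun x hx i hi => hx i hi.1
  obtain ⟨x, hx, hxn⟩ := Set.exists_of_ssubset (hsub.ssubset_of_ne hne.symm)
  have hξR : ∀ i ∈ C.normals, toReal ξ ⬝ᵥ toReal i = 1 := by
    intro i hi
    rw [toReal_dotProduct, hξ i hi, Int.cast_one]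
  have hxv : x ⬝ᵥ toReal v < 0 := by
    by_contra h
    push Not at h
    refine hxn fun i hi => ?_
    by_cases hiv : i = v
    · rwa [hiv]
    · exact hx i ⟨hi, hiv⟩
  refine ⟨x - (x ⬝ᵥ toReal v) • toReal ξ, ?_, fun i hi hiv => ?_⟩
  · simp [sub_dotProduct, hξR v hv]
  · have := hx i ⟨hi, hiv⟩
    simp only [sub_dotProduct, smul_dotProduct, hξR i hi, smul_eq_mul, mul_one]
    linarith

/-- The facet is a plane cone in the orthogonal complement of `v`, so the argument of
`RatCone.exists_two_normals` is repeated there, with `e` in the relative interior of the facet. -/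
theorem nonempty_facetRays (C : RatCone 3) {η : Fin 3 → ℝ} {δ : ℝ} (hδ : 0 < δ)
    (hC : ∀ u ∈ C.carrier, δ * ‖u‖ ≤ η ⬝ᵥ u) {ξ : Fin 3 → ℤ}
    (hξ : ∀ v ∈ C.normals, ξ ⬝ᵥ v = 1) {v : Fin 3 → ℤ} (hv : v ∈ C.normals) :
    Nonempty (FacetRays C v) := by
  classical
  have hv0 : toReal v ≠ 0 := toReal_ne_zero (C.primitive v hv).ne_zero
  obtain ⟨e, hev, he⟩ := C.exists_facet_point hξ hv
  have heC : e ∈ C.carrier := by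
    intro i hi
    by_cases hiv : i = v
    · rw [hiv, hev]
    · exact (he i hi hiv).le
  have hnot : ∀ y : Fin 3 → ℝ, y ≠ 0 → y ⬝ᵥ toReal v = 0 → η ⬝ᵥ y = 0 →
      ∃ i ∈ C.normals.erase v, y ⬝ᵥ toReal i < 0 := by
    intro y hy hyv hηy
    by_contra h
    push Not at h
    have h1 := hC y (fun i hi => by
      by_cases hiv : i = v
      · rw [hiv, hyv]
      · exact h i (Finset.mem_erase.mpr ⟨hiv, hi⟩))
    rw [hηy] at h1
    exact absurd h1 (not_le.mpr (mul_pos hδ (norm_pos_iff.mpr hy)))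
  -- If `e = 0`, then `v` is the only normal and the cone contains a line.
  have he0 : e ≠ 0 := by
    rintro rfl
    obtain ⟨p, hp, hpv⟩ := exists_orthogonal_ne_zero (toReal v)
    have honly : ∀ i ∈ C.normals, i = v := fun i hi => by
      by_contra hiv
      simpa using he i hi hiv
    refine hp (C.strictlyConvex p ?_ ?_)
    · intro i hi
      rw [honly i hi, hpv]
    · intro i hi
      rw [honly i hi, neg_dotProduct, hpv, neg_zero]
  have hηe : 0 < η ⬝ᵥ e := (mul_pos hδ (norm_pos_iff.mpr he0)).trans_le (hC e heC)
  -- The direction in the facet plane that is orthogonal to `η`.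
  set d := crossProduct (toReal v) η with hd
  have hdv : d ⬝ᵥ toReal v = 0 := by rw [dotProduct_comm]; exact dot_self_cross _ _
  have hηd : η ⬝ᵥ d = 0 := dot_cross_self _ _
  have hd0 : d ≠ 0 := by
    intro h
    have h0 := cross_cross_eq_smul_sub_smul (toReal v) η e
    rw [← hd, h, dotProduct_comm, hev, map_zero, LinearMap.zero_apply, zero_smul, zero_sub] at h0
    rcases smul_eq_zero.mp (neg_eq_zero.mp h0.symm) with h1 | h1
    · exact hηe.ne' h1
    · exact hv0 h1
  obtain ⟨a, ha, b, hb, hda, hdb, h1, h2⟩ := exists_extreme_pair (C.normals.erase v)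
    (fun i => e ⬝ᵥ toReal i) (fun i => d ⬝ᵥ toReal i)
    (fun i hi => he i (Finset.mem_of_mem_erase hi) (Finset.ne_of_mem_erase hi))
    (by
      obtain ⟨i, hi, h⟩ := hnot (-d) (neg_ne_zero.mpr hd0) (by rw [neg_dotProduct, hdv, neg_zero])
        (by rw [dotProduct_neg, hηd, neg_zero])
      exact ⟨i, hi, by rwa [neg_dotProduct, neg_lt_zero] at h⟩)
    (hnot d hd0 hdv hηd)
  have hea := he a (Finset.mem_of_mem_erase ha) (Finset.ne_of_mem_erase ha)
  have heb := he b (Finset.mem_of_mem_erase hb) (Finset.ne_of_mem_erase hb)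
  set D : ℤ := b ⬝ᵥ crossProduct v a with hD
  have hDR : toReal b ⬝ᵥ crossProduct (toReal v) (toReal a) = (D : ℝ) := by
    rw [← toReal_cross, toReal_dotProduct]
  have hvv := dotProduct_self_pos hv0
  have hD0 : (D : ℝ) ≠ 0 := by
    intro h
    have h3 := triple_mul_triple (a := toReal a) (b := toReal b) hev hdv
    rw [hDR, h, zero_mul] at h3
    have h4 := mul_pos heb hda
    have h5 := mul_pos (neg_pos.mpr hdb) hea
    rcases mul_eq_zero.mp h3.symm with h6 | h6
    · exact hvv.ne' h6
    · linarith
  have hdecomp : ∀ y : Fin 3 → ℝ, y ⬝ᵥ toReal v = 0 → ∃ σ τ : ℝ, y = σ • e + τ • d := by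
    intro y hy
    -- After this multiple of `e` is removed, the rest is orthogonal to `v` and `η`, hence parallel
    -- to `d`.
    set σ := (η ⬝ᵥ y) / (η ⬝ᵥ e) with hσ
    have h3 : η ⬝ᵥ (y - σ • e) = 0 := by
      rw [dotProduct_sub, dotProduct_smul, smul_eq_mul, hσ, div_mul_cancel₀ _ hηe.ne', sub_self]
    have h4 : (y - σ • e) ⬝ᵥ toReal v = 0 := by
      rw [sub_dotProduct, smul_dotProduct, hy, hev, smul_zero, sub_zero]
    have h5 : crossProduct d (y - σ • e) = 0 := by
      rw [hd, cross_cross_eq_smul_sub_smul, h3, dotProduct_comm, h4, zero_smul, zero_smul, sub_zero]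
    have h6 := dotProduct_smul_eq_of_cross_eq_zero h5
    refine ⟨σ, (d ⬝ᵥ d)⁻¹ * ((y - σ • e) ⬝ᵥ d), ?_⟩
    rw [mul_smul, ← h6, inv_smul_smul₀ (dotProduct_self_pos hd0).ne']
    abel
  let left : Fin 3 → ℤ := D • crossProduct v a
  let right : Fin 3 → ℤ := D • crossProduct b v
  have hl : toReal left = (D : ℝ) • crossProduct (toReal v) (toReal a) := by
    rw [← toReal_cross, ← toReal_smul]
  have hr : toReal right = (D : ℝ) • crossProduct (toReal b) (toReal v) := by
    rw [← toReal_cross, ← toReal_smul]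
  refine ⟨{
    a := a
    b := b
    left := left
    right := right
    scale := (D : ℝ) ^ 2
    a_mem := Finset.mem_of_mem_erase ha
    b_mem := Finset.mem_of_mem_erase hb
    a_ne := Finset.ne_of_mem_erase ha
    b_ne := Finset.ne_of_mem_erase hb
    scale_pos := by positivity
    left_v := by rw [hl, smul_dotProduct, dotProduct_comm, dot_self_cross, smul_zero]
    right_v := by rw [hr, smul_dotProduct, dotProduct_comm, dot_cross_self, smul_zero]
    left_a := by rw [hl, smul_dotProduct, dotProduct_comm, dot_cross_self, smul_zero]
    right_a := by
      rw [hr, smul_dotProduct, dotProduct_comm, triple_product_permutation, hDR, smul_eq_mul,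
        pow_two]
    left_b := by rw [hl, smul_dotProduct, dotProduct_comm, hDR, smul_eq_mul, pow_two]
    right_b := by rw [hr, smul_dotProduct, dotProduct_comm, dot_self_cross, smul_zero]
    eq_add := fun y hy => by
      have h3 := triple_smul_eq (a := toReal a) (b := toReal b) hy
      rw [hDR] at h3
      refine eq_div_smul_add_div_smul (by positivity) ?_
      rw [pow_two, mul_smul, h3, hl, hr]
      module
    mem_halfLine := fun β y hy hya hyb i hi hiv => by
      obtain ⟨σ, τ, rfl⟩ := hdecomp y hy
      simp only [add_dotProduct, smul_dotProduct, smul_eq_mul] at hya hyb ⊢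
      cases β
      · exact h1 σ τ hya hyb i (Finset.mem_erase.mpr ⟨hiv, hi⟩)
      · exact h2 σ τ hya hyb i (Finset.mem_erase.mpr ⟨hiv, hi⟩) }⟩

end Space

end GenSine

/-! ### Decomposition of a 1-Gorenstein cone and reciprocity in dimension three -/

namespace GenSine

open Filter Topology Set

section Space

theorem div_smul_eq_of_eq_smul {p q s : ℝ} {u y l : Fin 3 → ℝ} (hs : s ≠ 0) (hq : q ≠ 0)
    (hu : u = (p / s) • l) (hy : y = (q / s) • l) : (p / q) • y = u := by
  rw [hu, hy, smul_smul]
  congr 1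
  field_simp

namespace FacetRays

variable {C : RatCone 3} {v : Fin 3 → ℤ} (F : FacetRays C v) {ξ : Fin 3 → ℤ}
  (hξ : ∀ v ∈ C.normals, toReal ξ ⬝ᵥ toReal v = 1) (hv : v ∈ C.normals)

/-- The half-open simplicial cone over a facet and the vector `ξ`. -/
def prism (ξ : Fin 3 → ℤ) (o : Fin 3 → Bool) : Set (Fin 3 → ℤ) :=
  piece ![F.left, F.right, ξ] fun i => halfLine (o i)

include hξ

/-- Because `ξ` pairs to `1` with every normal, projecting along `ξ` onto the plane of `v` turns
pairings into their excess over the pairing with `v`. -/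
theorem sub_smul_dotProduct (x : Fin 3 → ℝ) {i : Fin 3 → ℤ} (hi : i ∈ C.normals) :
    (x - (x ⬝ᵥ toReal v) • toReal ξ) ⬝ᵥ toReal i = x ⬝ᵥ toReal i - x ⬝ᵥ toReal v := by
  simp [sub_dotProduct, hξ i hi]

include hv

theorem sub_smul_dotProduct_self (x : Fin 3 → ℝ) :
    (x - (x ⬝ᵥ toReal v) • toReal ξ) ⬝ᵥ toReal v = 0 := by
  rw [sub_smul_dotProduct hξ x hv, sub_self]

/-- Two comparisons, with `a` and `b`, decide whether `v` has the least pairing with `x`, that is,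
whether `x` lies over the facet of `v`. -/
theorem le_of_le {x : Fin 3 → ℝ} (ha : x ⬝ᵥ toReal v ≤ x ⬝ᵥ toReal F.a)
    (hb : x ⬝ᵥ toReal v ≤ x ⬝ᵥ toReal F.b) {i : Fin 3 → ℤ} (hi : i ∈ C.normals) :
    x ⬝ᵥ toReal v ≤ x ⬝ᵥ toReal i := by
  by_cases hiv : i = v
  · rw [hiv]
  have h := F.mem_halfLine false _ (sub_smul_dotProduct_self hξ hv x)
    (by rw [sub_smul_dotProduct hξ x F.a_mem]; simpa [halfLine] using ha)
    (by rw [sub_smul_dotProduct hξ x F.b_mem]; simpa [halfLine] using hb) i hi hiv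
  rw [sub_smul_dotProduct hξ x hi] at h
  simpa [halfLine] using h

theorem lt_of_lt {x : Fin 3 → ℝ} (ha : x ⬝ᵥ toReal v < x ⬝ᵥ toReal F.a)
    (hb : x ⬝ᵥ toReal v < x ⬝ᵥ toReal F.b) {i : Fin 3 → ℤ} (hi : i ∈ C.normals) (hiv : i ≠ v) :
    x ⬝ᵥ toReal v < x ⬝ᵥ toReal i := by
  have h := F.mem_halfLine true _ (sub_smul_dotProduct_self hξ hv x)
    (by rw [sub_smul_dotProduct hξ x F.a_mem]; simpa [halfLine] using ha)
    (by rw [sub_smul_dotProduct hξ x F.b_mem]; simpa [halfLine] using hb) i hi hiv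
  rw [sub_smul_dotProduct hξ x hi] at h
  simpa [halfLine] using h

theorem eq_smul_of_eq {x : Fin 3 → ℝ} (ha : x ⬝ᵥ toReal F.a = x ⬝ᵥ toReal v)
    (hb : x ⬝ᵥ toReal F.b = x ⬝ᵥ toReal v) : x = (x ⬝ᵥ toReal v) • toReal ξ := by
  have h := F.eq_add _ (sub_smul_dotProduct_self hξ hv x)
  rw [sub_smul_dotProduct hξ x F.a_mem, sub_smul_dotProduct hξ x F.b_mem, ha, hb] at h
  simpa [sub_eq_zero] using h

theorem sum_dotProduct_gens (c : Fin 3 → ℝ) :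
    (∑ i, c i • toReal (![F.left, F.right, ξ] i)) ⬝ᵥ toReal v = c 2 ∧
    (∑ i, c i • toReal (![F.left, F.right, ξ] i)) ⬝ᵥ toReal F.a - c 2 = c 1 * F.scale ∧
    (∑ i, c i • toReal (![F.left, F.right, ξ] i)) ⬝ᵥ toReal F.b - c 2 = c 0 * F.scale := by
  simp [Fin.sum_univ_three, add_dotProduct, F.left_v, F.right_v, F.left_a, F.left_b, F.right_a,
    F.right_b, hξ v hv, hξ F.a F.a_mem, hξ F.b F.b_mem]

theorem linearIndependent : LinearIndependent ℝ fun i => toReal (![F.left, F.right, ξ] i) := by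
  rw [Fintype.linearIndependent_iff]
  intro c hc
  obtain ⟨h2, h1, h0⟩ := F.sum_dotProduct_gens hξ hv c
  rw [hc, zero_dotProduct] at h0 h1 h2
  rw [← h2, sub_zero] at h0 h1
  rw [Fin.forall_fin_succ, Fin.forall_fin_two]
  have := F.scale_pos.ne'
  refine ⟨?_, ?_, h2.symm⟩
  · simpa [this] using h0.symm
  · simpa [this] using h1.symm

theorem mem_prism_iff {o : Fin 3 → Bool} {n : Fin 3 → ℤ} :
    n ∈ F.prism ξ o ↔
      toReal n ⬝ᵥ toReal F.b - toReal n ⬝ᵥ toReal v ∈ halfLine (o 0) ∧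
      toReal n ⬝ᵥ toReal F.a - toReal n ⬝ᵥ toReal v ∈ halfLine (o 1) ∧
      toReal n ⬝ᵥ toReal v ∈ halfLine (o 2) := by
  constructor
  · rintro ⟨c, hc, hn⟩
    obtain ⟨h2, h1, h0⟩ := F.sum_dotProduct_gens hξ hv c
    rw [← hn] at h0 h1 h2
    rw [h2, h1, h0, mul_mem_halfLine_iff F.scale_pos, mul_mem_halfLine_iff F.scale_pos]
    exact ⟨hc 0, hc 1, hc 2⟩
  · rintro ⟨h0, h1, h2⟩
    have h := F.eq_add _ (sub_smul_dotProduct_self hξ hv (toReal n))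
    rw [sub_smul_dotProduct hξ _ F.a_mem, sub_smul_dotProduct hξ _ F.b_mem] at h
    refine ⟨![(toReal n ⬝ᵥ toReal F.b - toReal n ⬝ᵥ toReal v) / F.scale,
      (toReal n ⬝ᵥ toReal F.a - toReal n ⬝ᵥ toReal v) / F.scale, toReal n ⬝ᵥ toReal v],
      ?_, ?_⟩
    rotate_left
    · rw [Fin.sum_univ_three]
      exact sub_eq_iff_eq_add.mp h
    · rw [Fin.forall_fin_succ, Fin.forall_fin_two]
      exact ⟨(smul_mem_halfLine_iff F.scale_pos).mpr h0,
        (smul_mem_halfLine_iff F.scale_pos).mpr h1, h2⟩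

/-- On a ray of a facet exactly two normals meet. -/
theorem card_eq_two (hgood : C.IsGood) {x : Fin 3 → ℝ}
    (hx : ∀ i ∈ C.normals, x ⬝ᵥ toReal v ≤ x ⬝ᵥ toReal i)
    (hne : x ≠ (x ⬝ᵥ toReal v) • toReal ξ)
    (hray : x ⬝ᵥ toReal F.a = x ⬝ᵥ toReal v ∨ x ⬝ᵥ toReal F.b = x ⬝ᵥ toReal v) :
    (C.normals.filter fun i => x ⬝ᵥ toReal i = x ⬝ᵥ toReal v).card = 2 := by
  set y := x - (x ⬝ᵥ toReal v) • toReal ξ with hy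
  have hyi : ∀ i ∈ C.normals, y ⬝ᵥ toReal i = x ⬝ᵥ toReal i - x ⬝ᵥ toReal v :=
    fun i hi => sub_smul_dotProduct hξ x hi
  have hy0 : y ≠ 0 := sub_ne_zero.mpr hne
  set I : Finset (Fin 3 → ℤ) := C.normals.filter fun i => x ⬝ᵥ toReal i = x ⬝ᵥ toReal v with hI
  have hmemI : ∀ i, i ∈ I ↔ i ∈ C.normals ∧ y ⬝ᵥ toReal i = 0 := by
    intro i
    rw [hI, Finset.mem_filter]
    exact and_congr_right fun hi => by rw [hyi i hi, sub_eq_zero]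
  have hyface : y ∈ C.face I := by
    refine ⟨fun i hi => ?_, fun i hi => ((hmemI i).mp hi).2⟩
    rw [hyi i hi, sub_nonneg]
    exact hx i hi
  have hvI : v ∈ I := (hmemI v).mpr ⟨hv, sub_smul_dotProduct_self hξ hv x⟩
  -- Besides `v`, one of `a` and `b` vanishes on this face, so it lies on a line; goodness then
  -- applies in codimension `2`.
  have hspan : Submodule.span ℝ (C.face I) = Submodule.span ℝ {y} := by
    refine le_antisymm (Submodule.span_le.mpr fun u hu => ?_)
      (Submodule.span_mono (singleton_subset_iff.mpr hyface))
    have huv := F.eq_add u (hu.2 v hvI)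
    have hyv := F.eq_add y (hyface.2 v hvI)
    rw [SetLike.mem_coe, Submodule.mem_span_singleton]
    have hs := F.scale_pos.ne'
    rcases hray with h | h
    · have haI : F.a ∈ I := by rw [hI, Finset.mem_filter]; exact ⟨F.a_mem, h⟩
      rw [hu.2 _ haI, zero_div, zero_smul, add_zero] at huv
      rw [hyface.2 _ haI, zero_div, zero_smul, add_zero] at hyv
      have hyb : y ⬝ᵥ toReal F.b ≠ 0 := fun h0 => hy0 (by rw [hyv, h0, zero_div, zero_smul])
      exact ⟨_, div_smul_eq_of_eq_smul hs hyb huv hyv⟩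
    · have hbI : F.b ∈ I := by rw [hI, Finset.mem_filter]; exact ⟨F.b_mem, h⟩
      rw [hu.2 _ hbI, zero_div, zero_smul, zero_add] at huv
      rw [hyface.2 _ hbI, zero_div, zero_smul, zero_add] at hyv
      have hya : y ⬝ᵥ toReal F.a ≠ 0 := fun h0 => hy0 (by rw [hyv, h0, zero_div, zero_smul])
      exact ⟨_, div_smul_eq_of_eq_smul hs hya huv hyv⟩
  have h := (hgood I (fun i hi => ((hmemI i).mp hi).1) 2 (by norm_num) (by norm_num) (by
    rw [hspan, finrank_span_singleton hy0])).1
  rw [← h, ← Set.ncard_coe_finset]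
  congr 1
  ext i
  constructor
  · intro hi
    exact ⟨((hmemI i).mp hi).1, fun u hu => hu.2 i hi⟩
  · rintro ⟨hi, hu⟩
    exact (hmemI i).mpr ⟨hi, hu y hyface⟩

end FacetRays

variable {C : RatCone 3}

/-- Let `m` be the least pairing of `x` with a normal. Only facets attaining `m` contribute. If one
normal attains it, both half-open prisms of that facet contain `x`. If `x` lies over an edge,
goodness gives two facets, each with exactly one prism containing `x`. On the line of `ξ` no prism
contains `x` and the ray term counts it twice. The total is always `2`. -/
theorem sum_prism_eq (hgood : C.IsGood) (F : ∀ v : C.normals, FacetRays C v) {ξ : Fin 3 → ℤ}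
    (hξ : ∀ v ∈ C.normals, toReal ξ ⬝ᵥ toReal v = 1) (β : Bool) :
    ∑ v : C.normals, (((F v).prism ξ ![true, false, β]).indicator (1 : (Fin 3 → ℤ) → ℂ)
        + ((F v).prism ξ ![false, true, β]).indicator 1)
      + (2 : ℂ) • (piece ![ξ] fun _ => halfLine β).indicator 1
      = (2 : ℂ) • (C.points β).indicator 1 := by
  classical
  funext n
  set x := toReal n with hx
  have hmono : ∀ {s t : ℝ}, s ∈ halfLine β → s ≤ t → t ∈ halfLine β := by
    intro s t hs hst
    cases β
    · simp [halfLine] at hs ⊢; linarith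
    · simp [halfLine] at hs ⊢; linarith
  have h1 : ∀ v : C.normals, n ∈ (F v).prism ξ ![true, false, β] ↔
      x ⬝ᵥ toReal v < x ⬝ᵥ toReal (F v).b ∧ x ⬝ᵥ toReal v ≤ x ⬝ᵥ toReal (F v).a ∧
        x ⬝ᵥ toReal v ∈ halfLine β := by
    intro v
    rw [(F v).mem_prism_iff hξ v.2]
    change _ - _ ∈ halfLine _ ∧ _ - _ ∈ halfLine _ ∧ x ⬝ᵥ toReal v ∈ halfLine β ↔ _
    refine and_congr ?_ (and_congr ?_ Iff.rfl) <;> simp [halfLine, hx]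
  have h2 : ∀ v : C.normals, n ∈ (F v).prism ξ ![false, true, β] ↔
      x ⬝ᵥ toReal v ≤ x ⬝ᵥ toReal (F v).b ∧ x ⬝ᵥ toReal v < x ⬝ᵥ toReal (F v).a ∧
        x ⬝ᵥ toReal v ∈ halfLine β := by
    intro v
    rw [(F v).mem_prism_iff hξ v.2]
    change _ - _ ∈ halfLine _ ∧ _ - _ ∈ halfLine _ ∧ x ⬝ᵥ toReal v ∈ halfLine β ↔ _
    refine and_congr ?_ (and_congr ?_ Iff.rfl) <;> simp [halfLine, hx]
  obtain ⟨v₀, hv₀, hmin⟩ := Finset.exists_min_image C.normals (fun v => x ⬝ᵥ toReal v)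
    (C.normals_nonempty (by norm_num))
  have hray : n ∈ (piece ![ξ] fun _ => halfLine β) ↔
      x ⬝ᵥ toReal v₀ ∈ halfLine β ∧ x = (x ⬝ᵥ toReal v₀) • toReal ξ := by
    constructor
    · rintro ⟨c, hc, hn⟩
      have hn' : x = c 0 • toReal ξ := by simpa using hn
      have h3 : x ⬝ᵥ toReal v₀ = c 0 := by rw [hn', smul_dotProduct, hξ v₀ hv₀]; simp
      rw [h3]
      exact ⟨hc 0, hn'⟩
    · rintro ⟨h3, h4⟩
      exact ⟨fun _ => x ⬝ᵥ toReal v₀, fun _ => h3, by simpa using h4⟩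
  simp only [Pi.add_apply, Finset.sum_apply, Pi.smul_apply, smul_eq_mul]
  set m := x ⬝ᵥ toReal v₀ with hm
  -- Membership in the cone or its interior depends only on the least pairing `m`.
  have hcone : n ∈ C.points β ↔ m ∈ halfLine β :=
    ⟨fun h => h v₀ hv₀, fun h v hv => hmono h (hmin v hv)⟩
  by_cases hmem : m ∈ halfLine β
  swap
  · have h3 : ∀ v : C.normals, x ⬝ᵥ toReal v ≤ x ⬝ᵥ toReal (F v).a →
        x ⬝ᵥ toReal v ≤ x ⬝ᵥ toReal (F v).b → x ⬝ᵥ toReal v ∉ halfLine β :=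
      fun v ha hb hv => hmem (hmono hv ((F v).le_of_le hξ v.2 ha hb hv₀))
    have h4 : ∀ v : C.normals, n ∉ (F v).prism ξ ![true, false, β] := fun v h => by
      obtain ⟨hb, ha, hv⟩ := (h1 v).mp h
      exact h3 v ha hb.le hv
    have h5 : ∀ v : C.normals, n ∉ (F v).prism ξ ![false, true, β] := fun v h => by
      obtain ⟨hb, ha, hv⟩ := (h2 v).mp h
      exact h3 v ha.le hb hv
    simp [h4, h5, hray, hcone, hmem]
  have key : ∀ c : ℂ, (∀ v : C.normals, x ⬝ᵥ toReal v = m →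
      ((F v).prism ξ ![true, false, β]).indicator (1 : (Fin 3 → ℤ) → ℂ) n
        + ((F v).prism ξ ![false, true, β]).indicator 1 n = c) →
      ∑ v : C.normals, (((F v).prism ξ ![true, false, β]).indicator (1 : (Fin 3 → ℤ) → ℂ) n
        + ((F v).prism ξ ![false, true, β]).indicator 1 n)
        = (C.normals.filter fun i => x ⬝ᵥ toReal i = m).card * c := by
    intro c hc
    rw [← nsmul_eq_mul, ← Finset.sum_const, Finset.sum_filter, ← Finset.sum_coe_sort C.normals]
    refine Finset.sum_congr rfl fun v _ => ?_
    split_ifs with h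
    · exact hc v h
    · have hlt : m < x ⬝ᵥ toReal v := lt_of_le_of_ne (hmin v v.2) (Ne.symm h)
      have h4 : n ∉ (F v).prism ξ ![true, false, β] := fun h => by
        obtain ⟨hb, ha, _⟩ := (h1 v).mp h
        exact hlt.not_ge ((F v).le_of_le hξ v.2 ha hb.le hv₀)
      have h5 : n ∉ (F v).prism ξ ![false, true, β] := fun h => by
        obtain ⟨hb, ha, _⟩ := (h2 v).mp h
        exact hlt.not_ge ((F v).le_of_le hξ v.2 ha.le hb hv₀)
      simp [h4, h5]
  have hmina : ∀ v : C.normals, m ≤ x ⬝ᵥ toReal (F v).a := fun v => hmin _ (F v).a_mem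
  have hminb : ∀ v : C.normals, m ≤ x ⬝ᵥ toReal (F v).b := fun v => hmin _ (F v).b_mem
  have h1' : ∀ v : C.normals, x ⬝ᵥ toReal v = m →
      (n ∈ (F v).prism ξ ![true, false, β] ↔ m < x ⬝ᵥ toReal (F v).b) := by
    intro v hv
    rw [h1, hv]
    exact ⟨fun h => h.1, fun h => ⟨h, hmina v, hmem⟩⟩
  have h2' : ∀ v : C.normals, x ⬝ᵥ toReal v = m →
      (n ∈ (F v).prism ξ ![false, true, β] ↔ m < x ⬝ᵥ toReal (F v).a) := by
    intro v hv
    rw [h2, hv]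
    exact ⟨fun h => h.2.1, fun h => ⟨hminb v, h, hmem⟩⟩
  simp only [indicator_of_mem (hcone.mpr hmem), Pi.one_apply, mul_one]
  by_cases hxm : x = m • toReal ξ
  · have hall : ∀ i ∈ C.normals, x ⬝ᵥ toReal i = m := by
      intro i hi
      rw [hxm, smul_dotProduct, hξ i hi, smul_eq_mul, mul_one]
    rw [key 0 fun v hv => by
      have h4 := (h1' v hv).not.mpr (by rw [hall _ (F v).b_mem]; exact lt_irrefl m)
      have h5 := (h2' v hv).not.mpr (by rw [hall _ (F v).a_mem]; exact lt_irrefl m)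
      simp [h4, h5]]
    rw [indicator_of_mem (hray.mpr ⟨hmem, hxm⟩)]
    simp
  rw [indicator_of_notMem (fun h => hxm (hray.mp h).2), mul_zero, add_zero]
  by_cases hint : m < x ⬝ᵥ toReal (F ⟨v₀, hv₀⟩).a ∧ m < x ⬝ᵥ toReal (F ⟨v₀, hv₀⟩).b
  · have huniq : ∀ i ∈ C.normals, x ⬝ᵥ toReal i = m → i = v₀ := fun i hi h => by
      by_contra hne
      exact ((F ⟨v₀, hv₀⟩).lt_of_lt hξ hv₀ hint.1 hint.2 hi hne).ne' h
    rw [key 2 fun v hv => by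
      obtain rfl : v = ⟨v₀, hv₀⟩ := Subtype.ext (huniq v v.2 hv)
      rw [indicator_of_mem ((h1' _ hv).mpr hint.2), indicator_of_mem ((h2' _ hv).mpr hint.1)]
      norm_num]
    have : (C.normals.filter fun i => x ⬝ᵥ toReal i = m) = {v₀} := by
      ext i
      simp only [Finset.mem_filter, Finset.mem_singleton]
      exact ⟨fun h => huniq i h.1 h.2, fun h => h ▸ ⟨hv₀, rfl⟩⟩
    rw [this]
    simp
  · have hcard : (C.normals.filter fun i => x ⬝ᵥ toReal i = m).card = 2 := by
      refine (F ⟨v₀, hv₀⟩).card_eq_two hξ hv₀ hgood hmin hxm ?_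
      by_contra h
      push Not at h
      exact hint ⟨lt_of_le_of_ne (hmina _) h.1.symm, lt_of_le_of_ne (hminb _) h.2.symm⟩
    rw [key 1 fun v hv => ?_]
    · rw [hcard]; norm_num
    · have hnboth : ¬ (m < x ⬝ᵥ toReal (F v).a ∧ m < x ⬝ᵥ toReal (F v).b) := by
        rintro ⟨ha, hb⟩
        have huniq : (C.normals.filter fun i => x ⬝ᵥ toReal i = m) ⊆ {(v : Fin 3 → ℤ)} := by
          intro i hi
          rw [Finset.mem_filter] at hi
          rw [Finset.mem_singleton]
          by_contra hne
          refine ((F v).lt_of_lt hξ v.2 (x := x) ?_ ?_ hi.1 hne).ne' (hi.2.trans hv.symm)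
          · rwa [hv]
          · rwa [hv]
        have := Finset.card_le_card huniq
        rw [hcard, Finset.card_singleton] at this
        omega
      have hone : m < x ⬝ᵥ toReal (F v).a ∨ m < x ⬝ᵥ toReal (F v).b := by
        by_contra h
        push Not at h
        refine hxm ?_
        have := (F v).eq_smul_of_eq hξ v.2 (x := x)
          (by rw [hv]; exact le_antisymm h.1 (hmina v))
          (by rw [hv]; exact le_antisymm h.2 (hminb v))
        rwa [hv] at this
      rcases hone with h | h
      · have hb := fun hb => hnboth ⟨h, hb⟩
        rw [indicator_of_mem ((h2' v hv).mpr h), indicator_of_notMem ((h1' v hv).not.mpr hb)]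
        simp
      · have ha := fun ha => hnboth ⟨ha, h⟩
        rw [indicator_of_mem ((h1' v hv).mpr h), indicator_of_notMem ((h2' v hv).not.mpr ha)]
        simp

/-- Complementing openness swaps the two prism families of a facet and opens the `ξ` direction, so
the decomposition of the closed cone becomes that of the interior. The ray has codimension `2`,
hence sign `+1`. -/
theorem RatCone.reciprocal_three (hgood : C.IsGood) (hG : C.IsOneGorenstein) {ω : Fin 3 → ℂ}
    {δ : ℝ} (hδ : 0 < δ) (hC : ∀ u ∈ C.carrier, δ * ‖u‖ ≤ (fun j => (ω j).re) ⬝ᵥ u) :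
    Reciprocal ω ((C.points false).indicator 1) ((C.points true).indicator 1) := by
  obtain ⟨ξ, -, hξZ⟩ := hG
  have hξ : ∀ v ∈ C.normals, toReal ξ ⬝ᵥ toReal v = 1 := by
    intro v hv
    rw [toReal_dotProduct, hξZ v hv, Int.cast_one]
  have hξC : toReal ξ ∈ C.carrier := fun v hv => by rw [hξ v hv]; exact zero_le_one
  let F : ∀ v : C.normals, FacetRays C v := fun v =>
    (nonempty_facetRays C hδ hC hξZ v.2).some
  have hgen : ∀ (v : C.normals) (i : Fin 3),
      toReal (![(F v).left, (F v).right, ξ] i) ∈ C.carrier := by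
    intro v i
    have hs := (F v).scale_pos.le
    have hface : ∀ u : Fin 3 → ℝ, u ⬝ᵥ toReal v = 0 → 0 ≤ u ⬝ᵥ toReal (F v).a →
        0 ≤ u ⬝ᵥ toReal (F v).b → u ∈ C.carrier := by
      intro u hu ha hb w hw
      by_cases hwv : w = v
      · rw [hwv, hu]
      · simpa [halfLine] using (F v).mem_halfLine false u hu (by simpa [halfLine] using ha)
          (by simpa [halfLine] using hb) w hw hwv
    fin_cases i
    · exact hface (toReal (F v).left) (F v).left_v (F v).left_a.ge (by rw [(F v).left_b]; exact hs)
    · exact hface (toReal (F v).right) (F v).right_v (by rw [(F v).right_a]; exact hs) (F v).right_b.ge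
    · exact hξC
  have hprism : ∀ (v : C.normals) (o o' : Fin 3 → Bool), (∀ i, o' i = !o i) →
      Reciprocal ω (((F v).prism ξ o).indicator 1) (((F v).prism ξ o').indicator 1) := by
    intro v o o' ho
    have h := RatCone.reciprocal_piece_of_mem hδ hC le_rfl
      ((F v).linearIndependent hξ v.2) (hgen v) o
    simp only [← ho, tsub_self, pow_zero, one_smul] at h
    exact h
  have hray : Reciprocal ω ((piece ![ξ] fun _ => halfLine false).indicator 1)
      ((piece ![ξ] fun _ => halfLine true).indicator 1) := by
    have hξ0 : toReal ξ ≠ 0 := by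
      obtain ⟨v, hv⟩ := C.normals_nonempty (by norm_num)
      intro h
      have := hξ v hv
      simp [h] at this
    have h := RatCone.reciprocal_piece_of_mem (k := 1) (w := ![ξ]) hδ hC (by norm_num)
      (by
        rw [Fintype.linearIndependent_iff]
        intro c hc i
        fin_cases i
        simpa [hξ0] using hc)
      (fun i => by fin_cases i; exact hξC) (fun _ => false)
    simpa using h
  have h := ((Reciprocal.sum Finset.univ fun v _ =>
    (hprism v ![true, false, false] ![false, true, true]
      (by intro i; fin_cases i <;> rfl)).add
    (hprism v ![false, true, false] ![true, false, true]
      (by intro i; fin_cases i <;> rfl))).add (hray.smul 2)).smul (1 / 2)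
  rw [sum_prism_eq hgood F hξ false] at h
  -- The complements arrive in the opposite order.
  simp only [add_comm (((F _).prism ξ ![false, true, true]).indicator 1)] at h
  rw [sum_prism_eq hgood F hξ true, smul_smul, smul_smul] at h
  simpa using h

end Space

end GenSine

/-! ### Uniqueness of the continuation and behaviour under scaling -/

namespace GenSine

open Filter Topology Set

variable {r : ℕ}

theorem isPreconnected_poleFree (r : ℕ) : IsPreconnected (poleFree r) := by
  have h : poleFree r = ((fun k : ℕ => (k : ℂ)) '' (Finset.Icc 1 r : Set ℕ))ᶜ := by
    ext s
    simp only [mem_ofPred_eq, mem_compl_iff, mem_image, not_exists, not_and, Finset.mem_coe]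
    exact ⟨fun h k hk hs => h k hk hs.symm, fun h k hk hs => h k hk hs.symm⟩
  rw [h]
  refine (Set.Countable.isConnected_compl_of_one_lt_rank ?_ ?_).isPreconnected
  · rw [Complex.rank_real_complex]
    exact Cardinal.one_lt_two
  · exact ((Finset.finite_toSet _).image _).countable

/-- The identity theorem on the connected complement of finitely many points; it makes the chosen
`coneZeta` computable from any continuation. -/
theorem IsZeta.eqOn {S : Set (Fin r → ℝ)} {θ : ℝ} {ω : Fin r → ℂ} {z : ℂ} {Z W : ℂ → ℂ}
    (hZ : IsZeta S θ ω z Z) (hW : IsZeta S θ ω z W) : EqOn Z W (poleFree r) := by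
  have hre : (r : ℝ) < ((r : ℂ) + 1).re := by simp
  refine (hZ.1.analyticOnNhd (isOpen_poleFree r)).eqOn_of_preconnected_of_eventuallyEq
    (hW.1.analyticOnNhd (isOpen_poleFree r)) (isPreconnected_poleFree r)
    (z₀ := (r : ℂ) + 1) ?_ ?_
  · rintro k hk h
    have h1 := (Finset.mem_Icc.mp hk).2
    have h2 : r + 1 = k := by exact_mod_cast h
    omega
  · filter_upwards [(isOpen_lt continuous_const Complex.continuous_re).mem_nhds hre] with s hs
    exact (hZ.2 s hs).unique (hW.2 s hs)

theorem IsZeta.coneGamma_eq {S : Set (Fin r → ℝ)} {θ : ℝ} {ω : Fin r → ℂ} {z : ℂ} {Z : ℂ → ℂ}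
    (hZ : IsZeta S θ ω z Z) (hreg : Regular S ω z) :
    coneGamma S θ ω z = Complex.exp (deriv Z 0) := by
  have hex : ∃ Z : ℂ → ℂ, IsZeta S θ ω z Z := ⟨Z, hZ⟩
  rw [coneGamma, if_pos hreg, coneZeta, dif_pos hex]
  congr 1
  refine EventuallyEq.deriv_eq ?_
  filter_upwards [(isOpen_poleFree r).mem_nhds (zero_mem_poleFree r)] with s hs
  exact hex.choose_spec.eqOn hZ hs

theorem exp_branchLog (θ : ℝ) {x : ℂ} (hx : x ≠ 0) : Complex.exp (branchLog θ x) = x := by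
  rw [branchLog, Complex.exp_add, Complex.exp_log (mul_ne_zero (Complex.exp_ne_zero _) hx),
    mul_right_comm, ← Complex.exp_add]
  simp

/-- The constant by which the branches of the logarithm at `x` and `c x` differ on the
intersection of the two half planes. -/
def logShift (θ θ' : ℝ) (c : ℂ) : ℂ :=
  Complex.log (Complex.exp (-(θ' * Complex.I)) * Complex.exp (θ * Complex.I) * c)
    + (θ' - θ) * Complex.I

theorem exp_logShift (θ θ' : ℝ) {c : ℂ} (hc : c ≠ 0) : Complex.exp (logShift θ θ' c) = c := by
  rw [logShift, Complex.exp_add, Complex.exp_log (by simp [hc, Complex.exp_ne_zero]),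
    mul_right_comm, ← Complex.exp_add, ← Complex.exp_add]
  ring_nf
  simp

theorem log_mul_inv_of_re_pos {x y : ℂ} (hx : 0 < x.re) (hy : 0 < y.re) :
    Complex.log (y * x⁻¹) = Complex.log y - Complex.log x := by
  have hx0 : x ≠ 0 := by rintro rfl; simp at hx
  have hy0 : y ≠ 0 := by rintro rfl; simp at hy
  have hax := abs_lt.mp (Complex.abs_arg_lt_pi_div_two_iff.mpr (Or.inl hx))
  have hay := abs_lt.mp (Complex.abs_arg_lt_pi_div_two_iff.mpr (Or.inl hy))
  have hne : x.arg ≠ Real.pi := by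
    have := Real.pi_pos
    intro h
    linarith [hax.2]
  have harg : x⁻¹.arg = -x.arg := by rw [Complex.arg_inv, if_neg hne]
  rw [(Complex.log_mul_eq_add_log_iff hy0 (inv_ne_zero hx0)).mpr, Complex.log_inv _ hne,
    sub_eq_add_neg]
  rw [harg]
  constructor <;> linarith [hax.1, hax.2, hay.1, hay.2]

/-- Both rotated numbers have argument in `(-π/2, π/2)`, so the principal logarithm of their
quotient is the difference of logarithms, and that quotient does not depend on `x`. -/
theorem branchLog_mul {θ θ' : ℝ} {c x : ℂ} (hx : 0 < (Complex.exp (-(θ * Complex.I)) * x).re)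
    (hx' : 0 < (Complex.exp (-(θ' * Complex.I)) * (c * x)).re) :
    branchLog θ' (c * x) = branchLog θ x + logShift θ θ' c := by
  have h := log_mul_inv_of_re_pos hx hx'
  have hx0 : x ≠ 0 := by rintro rfl; simp at hx
  have e : Complex.exp (-(θ' * Complex.I)) * (c * x) * (Complex.exp (-(θ * Complex.I)) * x)⁻¹
      = Complex.exp (-(θ' * Complex.I)) * Complex.exp (θ * Complex.I) * c := by
    rw [mul_inv, ← Complex.exp_neg, neg_neg]
    field_simp
  rw [e] at h
  rw [branchLog, branchLog, logShift, h]
  ring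

theorem shifted_const_mul (ω : Fin r → ℂ) (c z : ℂ) (n : Fin r → ℤ) :
    shifted (fun j => c * ω j) (c * z) n = c * shifted ω z n := by
  rw [shifted_eq, shifted_eq, pairing_const_mul, mul_add]

theorem regular_const_mul {S : Set (Fin r → ℝ)} {ω : Fin r → ℂ} {c : ℂ} (hc : c ≠ 0) (z : ℂ) :
    Regular S (fun j => c * ω j) (c * z) ↔ Regular S ω z := by
  simp only [Regular, shifted_const_mul, ne_eq, mul_eq_zero, hc, false_or]

/-- Outside a finite set every logarithm shifts by `L`, so that part of the zeta function is
multiplied by `e^{-sL}`. Differentiating at `0` gives `-L Z(0)` and a finite correction `∑ (L + l n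
- l' n)`, each summand of which exponentiates to `1`. -/
theorem coneGamma_const_mul {S : Set (Fin r → ℝ)} {θ θ' δ δ' : ℝ} (hδ : 0 < δ) (hδ' : 0 < δ')
    {ω : Fin r → ℂ} {c : ℂ} (hc : c ≠ 0) (hS : ∀ u ∈ S, δ * ‖u‖ ≤ rotatedRe θ ω ⬝ᵥ u)
    (hS' : ∀ u ∈ S, δ' * ‖u‖ ≤ rotatedRe θ' (fun j => c * ω j) ⬝ᵥ u) {z : ℂ} {Z : ℂ → ℂ}
    (hZ : IsZeta S θ ω z Z) (hreg : Regular S ω z) :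
    coneGamma S θ' (fun j => c * ω j) (c * z)
      = coneGamma S θ ω z * Complex.exp (-(logShift θ θ' c * Z 0)) := by
  classical
  have hfin := finite_re_rotated_shifted_lt hδ hS z
  have hfin' := finite_re_rotated_shifted_lt hδ' hS' (c * z)
  let B : Finset (latticePoints S) := hfin.toFinset ∪ hfin'.toFinset
  set L := logShift θ θ' c with hL
  let l : latticePoints S → ℂ := fun n => branchLog θ (shifted ω z n)
  let l' : latticePoints S → ℂ := fun n => branchLog θ' (c * shifted ω z n)
  have hB : ∀ n ∉ B, l' n = l n + L := by
    intro n hn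
    simp only [B, Finset.mem_union, Set.Finite.mem_toFinset, mem_ofPred_eq, not_or, not_lt,
      shifted_const_mul] at hn
    exact branchLog_mul (one_pos.trans_le hn.1) (one_pos.trans_le hn.2)
  let Z' : ℂ → ℂ := fun s => Complex.exp (-s * L) * (Z s - ∑ n ∈ B, Complex.exp (-s * l n))
    + ∑ n ∈ B, Complex.exp (-s * l' n)
  have hZ' : IsZeta S θ' (fun j => c * ω j) (c * z) Z' := by
    refine ⟨?_, fun s hs => ?_⟩
    · have := hZ.1
      refine DifferentiableOn.add (DifferentiableOn.mul (by fun_prop)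
        (DifferentiableOn.sub this (by fun_prop))) (by fun_prop)
    · simp only [shifted_const_mul]
      refine (B.hasSum_compl_iff (f := fun n => Complex.exp (-s * l' n))).mp ?_
      have h1 : HasSum (fun n : {n // n ∉ B} => Complex.exp (-s * l n))
          (Z s - ∑ n ∈ B, Complex.exp (-s * l n)) := by
        rw [B.hasSum_compl_iff (f := fun n => Complex.exp (-s * l n)), sub_add_cancel]
        exact hZ.2 s hs
      convert! h1.mul_left (Complex.exp (-s * L)) using 2 with n
      rw [hB n n.2, ← Complex.exp_add]
      ring_nf
  have hdZ : HasDerivAt Z (deriv Z 0) 0 :=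
    ((hZ.1 0 (zero_mem_poleFree r)).differentiableAt
      ((isOpen_poleFree r).mem_nhds (zero_mem_poleFree r))).hasDerivAt
  have hexp : ∀ a : ℂ, HasDerivAt (fun s : ℂ => Complex.exp (-s * a)) (-a) 0 := by
    intro a
    simpa using! ((hasDerivAt_id (0 : ℂ)).neg.mul_const a).cexp
  have hsum : ∀ a : latticePoints S → ℂ,
      HasDerivAt (fun s : ℂ => ∑ n ∈ B, Complex.exp (-s * a n)) (∑ n ∈ B, -a n) 0 :=
    fun a => HasDerivAt.fun_sum fun n _ => hexp (a n)
  have hd := ((hexp L).mul (hdZ.sub (hsum l))).add (hsum l')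
  have hd' : deriv Z' 0 = deriv Z 0 + -(L * Z 0) + ∑ n ∈ B, (L + l n - l' n) := by
    refine (HasDerivAt.deriv (f := Z') hd).trans ?_
    simp only [neg_zero, zero_mul, Complex.exp_zero, Finset.sum_const, nsmul_eq_mul, mul_one,
      one_mul, Finset.sum_neg_distrib, Finset.sum_sub_distrib, Finset.sum_add_distrib, Pi.sub_apply]
    ring
  rw [hZ'.coneGamma_eq ((regular_const_mul hc z).mpr hreg), hZ.coneGamma_eq hreg, hd',
    Complex.exp_add, Complex.exp_add, Complex.exp_sum, Finset.prod_eq_one, mul_one]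
  intro n _
  have hn := hreg n n.2
  rw [Complex.exp_sub, Complex.exp_add, exp_logShift θ θ' hc, exp_branchLog θ hn,
    exp_branchLog θ' (mul_ne_zero hc hn), div_self (mul_ne_zero hc hn)]

theorem RatCone.exists_isZeta_pair (C : RatCone r) (hgood : C.IsGood)
    (hr : r = 2 ∨ (r = 3 ∧ C.IsOneGorenstein)) {ω : Fin r → ℂ} {θ : ℝ}
    (hθ : C.Admissible ω θ) (z : ℂ) :
    ∃ Z W : ℂ → ℂ, IsZeta C.carrier θ ω z Z ∧ IsZeta (interior C.carrier) θ ω (-z) W ∧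
      W 0 = (-1) ^ r * Z 0 := by
  obtain ⟨δ, hδ, hC⟩ := exists_pos_mul_norm_le hθ
  refine exists_isZeta_of_reciprocal hδ hC interior_subset ?_ z
  rw [← C.points_false, ← C.points_true]
  rcases hr with rfl | ⟨rfl, hG⟩
  · exact C.reciprocal_two hδ hC
  · exact RatCone.reciprocal_three hgood hG hδ hC

end GenSine

end

theorem mainTheorem8 {r : ℕ} (C : GenSine.RatCone r) (hgood : C.IsGood)
    (hr : r = 2 ∨ (r = 3 ∧ C.IsOneGorenstein))
    (ω : Fin r → ℂ) (c : ℂ) (hc : c ≠ 0)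
    (θ θ' : ℝ) (hθ : C.Admissible ω θ) (hθ' : C.Admissible (fun j => c * ω j) θ') (z : ℂ) :
    (GenSine.Regular C.carrier ω z →
      ∃ Z : ℂ → ℂ, GenSine.IsZeta C.carrier θ ω z Z) ∧
    (GenSine.Regular (interior C.carrier) ω (-z) →
      ∃ Z : ℂ → ℂ, GenSine.IsZeta (interior C.carrier) θ ω (-z) Z) ∧
    GenSine.coneSine C θ' (fun j => c * ω j) (c * z) = GenSine.coneSine C θ ω z := by
  obtain ⟨Z, W, hZ, hW, h0⟩ := C.exists_isZeta_pair hgood hr hθ z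
  refine ⟨fun _ => ⟨Z, hZ⟩, fun _ => ⟨W, hW⟩, ?_⟩
  obtain ⟨δ, hδ, hS⟩ := GenSine.exists_pos_mul_norm_le hθ
  obtain ⟨δ', hδ', hS'⟩ := GenSine.exists_pos_mul_norm_le hθ'
  rw [GenSine.coneSine, GenSine.coneSine, ← mul_neg]
  by_cases h1 : GenSine.Regular C.carrier ω z
  swap
  -- At a pole both gamma values are `0` by convention, so both sines vanish.
  · have h1' := (GenSine.regular_const_mul (S := C.carrier) hc z).not.mpr h1
    simp [GenSine.coneGamma, h1, h1']
  by_cases h2 : GenSine.Regular (interior C.carrier) ω (-z)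
  swap
  · have h2' := (GenSine.regular_const_mul (S := interior C.carrier) hc (-z)).not.mpr h2
    -- The convention `0⁻¹ = 0` makes the factor vanish also for the exponent `-1`.
    have hne : ((-1 : ℤ) ^ r) ≠ 0 := pow_ne_zero _ (by norm_num)
    simp only [GenSine.coneGamma, h2, h2', if_false, zero_zpow _ hne, mul_zero]
  rw [GenSine.coneGamma_const_mul hδ hδ' hc hS hS' hZ h1,
    GenSine.coneGamma_const_mul hδ hδ' hc (fun u hu => hS u (interior_subset hu))
      (fun u hu => hS' u (interior_subset hu)) hW h2, h0]
  have he := Complex.exp_ne_zero (GenSine.logShift θ θ' c * Z 0)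
  -- The scaling factors are `exp (L Z(0))` from the inverse gamma function of `C` and `exp (-L
  -- Z(0))` from the interior, since the sign in `W 0` squares away against the exponent.
  rcases Nat.even_or_odd r with hev | hodd
  · rw [hev.neg_one_pow, hev.neg_one_pow, one_mul, zpow_one, zpow_one, Complex.exp_neg]
    field_simp
  · rw [hodd.neg_one_pow, hodd.neg_one_pow, zpow_neg_one, zpow_neg_one, neg_one_mul, mul_neg,
      neg_neg, Complex.exp_neg]
    field_simp
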